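/- **Theorem (NPMLE consistency).** Let $q,m$ be fixed positive integers and let $R:t\mapsto\{R_t^{(i)}\}_{i=1}^m$ assign to each $t\in\mathbb{R}^q$ a partition of $\mathbb{R}$ into $m$ Borel sets (possibly empty). Let $\mathcal{Y}\subset\mathbb{R}$, let $(T_j,Y_j)_{j\ge 1}$ be i.i.d. pairs with values in $\mathbb{R}^q\times\mathbb{R}$ such that $T_j$ is independent of $Y_j$ and $Y_j\in\mathcal{Y}$ almost surely, and let $F_Y$ be the distribution function of $Y_j$. Write $F(r)$ for the probability of a Borel set $r$ under a (right-continuous) distribution function $F$. Assume that $F_Y$ is continuous and that the following two conditions hold. *Resolvability.* The law of $T_1$ has a density with respect to Lebesgue measure on $\mathbb{R}^q$, and every $y\in\overline{\mathcal{Y}}$ has an open neighborhood $N(y)\subset\mathbb{R}$ such that for all $y_a,y_b\in N(y)$ there are $t,t'$ in the support of the law of $T_1$ and $k,\ell\in\{1,\dots,m\}$ with $(y_a,y_b]\cap R_t^{(k)}=\emptyset$ and $(y_a,y_b]\cup R_t^{(k)}=R_{t'}^{(\ell)}$. *Monotonicity.* For every distribution function $F$ on $\mathbb{R}$: (a) for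 all $j\in\{1,\dots,q\}$ and $i\in\{1,\dots,m\}$, with the entries $t^{(j')}$, $j'\ne j$, held fixed, $F(R_t^{(i)})$ is either non-decreasing or non-increasing in $t^{(j)}$; (b) there are functions $G^{(1)},\dots,G^{(q)}$, non-decreasing, continuous and bounded on $[0,1]$, such that for all $j$, all $i$, and all $t_a,t_b\in\mathbb{R}^q$ differing only in the $j$-th entry, $$|F(R_{t_b}^{(i)})-F(R_{t_a}^{(i)})|\le |G^{(j)}(F(t_b^{(j)}))-G^{(j)}(F(t_a^{(j)}))|.$$ For each $n\ge1$ let $\hat F_n$ be a nonparametric maximum likelihood estimator based on the range data, that is, almost surely $\hat F_n$ is a maximizer of $$\psi_n(F)=\frac1n\sum_{j=1}^n\sum_{i=1}^m \mathbf{1}\{Y_j\in R_{T_j}^{(i)}\}\,\log F\bigl(R_{T_j}^{(i)}\bigr)\in[-\infty,0]$$ over all right-continuous distribution functions $F$ on $\mathcal{Y}$ (those giving probability one to $\mathcal{Y}$), with the conventions $\log 0=-\infty$ and $0\cdot(-\infty)=0$. Then $$\sup_{y\in\mathcal{Y}}|\hat F_n(y)-F_Y(y)|\longrightarrow 0\quad\text{almost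 surely as } n\to\infty .$$ -/

import Mathlib

open MeasureTheory ProbabilityTheory Filter Topology
open scoped ENNReal

noncomputable section

namespace RangePrivacy

/-- A map `t ↦ (R_t^(1), …, R_t^(m))` sending each `t ∈ ℝ^q` to a partition of the real line into
`m` (possibly empty) Borel ranges. -/
structure RangeMap (q m : ℕ) where
  range : (Fin q → ℝ) → Fin m → Set ℝ
  measurableSet_range : ∀ t i, MeasurableSet (range t i)
  disjoint_range : ∀ t i j, i ≠ j → Disjoint (range t i) (range t j)
  iUnion_range : ∀ t, ⋃ i, range t i = Set.univ

variable {q m : ℕ}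

/-- The data set `(T_j)_j`, `(Y_j)_j` of size `n` enters the log-likelihood
`ψ(F) = (1/n) ∑_j ∑_i B_j^(i) log F(R_{T_j}^(i))` only through `T_j` and the indicators
`B_j^(i) = 1{Y_j ∈ R_{T_j}^(i)}`. A right-continuous distribution function `F` is given as the
probability measure on `ℝ` that it induces. The values are extended real with `log 0 = -∞`, and a
term whose indicator is `0` contributes `0`. -/
def logLikelihood (R : RangeMap q m) {n : ℕ} (T : Fin n → Fin q → ℝ) (Y : Fin n → ℝ)
    (F : ProbabilityMeasure ℝ) : EReal :=
  (((n : ℝ)⁻¹ : ℝ) : EReal) *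
    ∑ j, ∑ i, (R.range (T j) i).indicator
      (fun _ => ENNReal.log ((F : Measure ℝ) (R.range (T j) i))) (Y j)

/-- `F` is a distribution function on `𝒴`: it gives mass one to `𝒴`. -/
def IsDistributionOn (𝒴 : Set ℝ) (F : ProbabilityMeasure ℝ) : Prop :=
  ∀ᵐ y ∂(F : Measure ℝ), y ∈ 𝒴

/-- `Fhat` maximizes the log-likelihood over all distribution functions on `𝒴`. -/
def IsNPMLE (𝒴 : Set ℝ) (R : RangeMap q m) {n : ℕ} (T : Fin n → Fin q → ℝ) (Y : Fin n → ℝ)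
    (Fhat : ProbabilityMeasure ℝ) : Prop :=
  IsDistributionOn 𝒴 Fhat ∧
    ∀ F : ProbabilityMeasure ℝ, IsDistributionOn 𝒴 F →
      logLikelihood R T Y F ≤ logLikelihood R T Y Fhat

/-- Resolvability, for `T` with law `PT`: `T` has a Lebesgue density, and around each point of the
closure of `𝒴` every small interval `(a, b]` is the difference of two feasible ranges. -/
def Resolvability (𝒴 : Set ℝ) (R : RangeMap q m) (PT : Measure (Fin q → ℝ)) : Prop :=
  (∃ p : (Fin q → ℝ) → ℝ≥0∞, Measurable p ∧ PT = volume.withDensity p) ∧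
    ∀ y ∈ closure 𝒴, ∃ N : Set ℝ, IsOpen N ∧ y ∈ N ∧ ∀ a ∈ N, ∀ b ∈ N,
      ∃ t ∈ PT.support, ∃ t' ∈ PT.support, ∃ k l : Fin m,
        Set.Ioc a b ∩ R.range t k = ∅ ∧ Set.Ioc a b ∪ R.range t k = R.range t' l

/-- Monotonicity: for every distribution function `F`, each `F(R_t^(i))` is monotone in each single
entry of `t`, and its increments are controlled by those of `G^(j) ∘ F`. -/
def Monotonicity (R : RangeMap q m) : Prop :=
  ∀ F : ProbabilityMeasure ℝ,
    (∀ (j : Fin q) (i : Fin m) (t : Fin q → ℝ),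
      Monotone (fun s => (F : Measure ℝ).real (R.range (Function.update t j s) i)) ∨
        Antitone (fun s => (F : Measure ℝ).real (R.range (Function.update t j s) i))) ∧
    ∃ G : Fin q → ℝ → ℝ,
      (∀ j, MonotoneOn (G j) (Set.Icc 0 1) ∧ ContinuousOn (G j) (Set.Icc 0 1) ∧
        Bornology.IsBounded (G j '' Set.Icc 0 1)) ∧
      ∀ (j : Fin q) (i : Fin m) (ta tb : Fin q → ℝ), (∀ j', j' ≠ j → ta j' = tb j') →
        |(F : Measure ℝ).real (R.range tb i) - (F : Measure ℝ).real (R.range ta i)| ≤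
          |G j (cdf (F : Measure ℝ) (tb j)) - G j (cdf (F : Measure ℝ) (ta j))|

end RangePrivacy

end

/-!
By compactness, along any ultrafilter the estimators `F̂_n` converge setwise to a finitely additive
probability `M`. Comparing the maximizer `F̂_n` with its mixtures with the true law `P_Y` gives the
first-order condition that the empirical mean of `P_Y(r) / F̂_n(r)` over the observed ranges `r` is
at most `1`. Monotonicity, applied to point masses, shows that whether `y` lies in `R_t^(i)` depends
only on the order of `y` relative to the entries of `t`. Hence `F(R_t^(i))` varies little, whatever
`F` is, on most blocks of a fine quantile grid in the parameter space, and the law of large numbers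
on the finitely many blocks yields `E[P_Y(r) / (M(r) + δ)] ≤ 1` for every `δ > 0`. Since chi-square
divergences are nonnegative, this forces `M(R_t^(i)) = P_Y(R_t^(i))` for almost every parameter `t`.

The equality need not hold at every `t` of the support, as `M` may have jumps, but `t ↦ M(R_t^(i))`
has only countably many different jumps, so on the support the error `M(R_t^(i)) - P_Y(R_t^(i))`
takes countably many values. By resolvability so does, locally, the error of `M` on intervals
`(a, b]`. As `x ↦ M((-∞, x]) - F_Y(x)` is an increasing function minus a continuous one, it can
decrease only through a continuum of values; hence it is locally increasing, and it vanishes since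
it tends to something `≥ 0` at `-∞` and `≤ 0` at `+∞`. Pointwise convergence to the continuous `F_Y`
is then uniform.
-/

noncomputable section

namespace RangePrivacy

/-- A finitely additive probability on the measurable sets of `α`. Pointwise limits of probability
measures are of this kind, although they need not be countably additive. -/
structure IsProbabilityContent {α : Type*} [MeasurableSpace α] (M : Set α → ℝ) : Prop where
  nonneg : ∀ A, 0 ≤ M A
  univ : M Set.univ = 1
  union : ∀ ⦃A B⦄, MeasurableSet A → MeasurableSet B → Disjoint A B → M (A ∪ B) = M A + M B

theorem isProbabilityContent_real {α : Type*} [MeasurableSpace α] (μ : Measure α)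
    [IsProbabilityMeasure μ] : IsProbabilityContent μ.real where
  nonneg _ := measureReal_nonneg
  univ := probReal_univ
  union _ _ _ hB h := measureReal_union h hB

theorem IsProbabilityContent.of_tendsto {α ι : Type*} [MeasurableSpace α] {𝒰 : Filter ι} [𝒰.NeBot]
    {F : ι → Set α → ℝ} {M : Set α → ℝ} (hF : ∀ n, IsProbabilityContent (F n))
    (hM : Tendsto F 𝒰 (𝓝 M)) : IsProbabilityContent M where
  nonneg A := ge_of_tendsto' (hM.apply_nhds A) fun n => (hF n).nonneg A
  univ := tendsto_nhds_unique (hM.apply_nhds _) (tendsto_const_nhds.congr fun n => (hF n).univ.symm)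
  union A B hA hB h := tendsto_nhds_unique (hM.apply_nhds _)
    (((hM.apply_nhds A).add (hM.apply_nhds B)).congr fun n => ((hF n).union hA hB h).symm)

namespace IsProbabilityContent

variable {α : Type*} [MeasurableSpace α] {M : Set α → ℝ} {A B : Set α}

theorem empty (hM : IsProbabilityContent M) : M ∅ = 0 := by
  simpa using hM.union .empty .empty (Set.disjoint_empty ∅)

theorem inter_add_sdiff (hM : IsProbabilityContent M) (hA : MeasurableSet A)
    (hB : MeasurableSet B) : M (A ∩ B) + M (A \ B) = M A := by
  rw [← hM.union (hA.inter hB) (hA.diff hB) Set.disjoint_sdiff_inter.symm, Set.inter_union_sdiff]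

theorem mono (hM : IsProbabilityContent M) (hA : MeasurableSet A) (hB : MeasurableSet B)
    (h : A ⊆ B) : M A ≤ M B := by
  rw [← hM.inter_add_sdiff hB hA, Set.inter_eq_right.2 h]
  exact le_add_of_nonneg_right (hM.nonneg _)

theorem le_one (hM : IsProbabilityContent M) (hA : MeasurableSet A) : M A ≤ 1 :=
  (hM.mono hA .univ (Set.subset_univ A)).trans_eq hM.univ

theorem sub_le_sdiff (hM : IsProbabilityContent M) (hA : MeasurableSet A) (hB : MeasurableSet B) :
    M A - M B ≤ M (A \ B) := by
  linarith [hM.inter_add_sdiff hA hB, hM.mono (hA.inter hB) hB Set.inter_subset_right]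

theorem union_le (hM : IsProbabilityContent M) (hA : MeasurableSet A) (hB : MeasurableSet B) :
    M (A ∪ B) ≤ M A + M B := by
  rw [← Set.union_sdiff_self, hM.union hA (hB.diff hA) Set.disjoint_sdiff_right]
  gcongr
  exact hM.mono (hB.diff hA) hB Set.sdiff_subset

theorem biUnion_finset {ι : Type*} (hM : IsProbabilityContent M) {s : Finset ι} {A : ι → Set α}
    (hd : (s : Set ι).PairwiseDisjoint A) (hA : ∀ i ∈ s, MeasurableSet (A i)) :
    M (⋃ i ∈ s, A i) = ∑ i ∈ s, M (A i) := by
  classical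
  induction s using Finset.induction_on with
  | empty => simp [hM.empty]
  | insert i s hi ih =>
    simp only [Finset.mem_insert, forall_eq_or_imp] at hA
    rw [Finset.coe_insert, Set.pairwiseDisjoint_insert_of_notMem (by simpa)] at hd
    rw [Finset.set_biUnion_insert, Finset.sum_insert hi, ← ih hd.1 hA.2,
      hM.union hA.1 (s.measurableSet_biUnion hA.2) (Set.disjoint_iUnion₂_right.2 hd.2)]

theorem iUnion_fintype {ι : Type*} [Fintype ι] (hM : IsProbabilityContent M) {A : ι → Set α}
    (hd : Pairwise (Function.onFun Disjoint A)) (hA : ∀ i, MeasurableSet (A i)) :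
    M (⋃ i, A i) = ∑ i, M (A i) := by
  simpa using hM.biUnion_finset (s := Finset.univ) (hd.set_pairwise _) fun i _ => hA i

theorem iUnion_fintype_le {ι : Type*} [Fintype ι] (hM : IsProbabilityContent M) {A : ι → Set α}
    (hA : ∀ i, MeasurableSet (A i)) : M (⋃ i, A i) ≤ ∑ i, M (A i) := by
  classical
  suffices ∀ s : Finset ι, M (⋃ i ∈ s, A i) ≤ ∑ i ∈ s, M (A i) by simpa using this Finset.univ
  intro s
  induction s using Finset.induction_on with
  | empty => simp [hM.empty]
  | insert i s hi ih =>
    rw [Finset.set_biUnion_insert, Finset.sum_insert hi]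
    exact (hM.union_le (hA i) (s.measurableSet_biUnion fun j _ => hA j)).trans (by gcongr)

end IsProbabilityContent

theorem exists_tendsto_ultrafilter_of_mem_Icc {ι E : Type*} [TopologicalSpace E] [Preorder E]
    [CompactIccSpace E] (𝒰 : Ultrafilter ι) {f : ι → E} {a b : E} (hf : ∀ n, f n ∈ Set.Icc a b) :
    ∃ x, Tendsto f 𝒰 (𝓝 x) := by
  have hmem : (𝒰.map f : Filter E) ≤ 𝓟 (Set.Icc a b) :=
    le_principal_iff.2 (Ultrafilter.mem_map.2 (Eventually.of_forall hf))
  obtain ⟨x, -, hx⟩ := (isCompact_Icc (a := a) (b := b)).ultrafilter_le_nhds (𝒰.map f) hmem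
  exact ⟨x, hx⟩

theorem exists_isProbabilityContent_tendsto {α ι : Type*} [MeasurableSpace α] (𝒰 : Ultrafilter ι)
    (μ : ι → Measure α) [∀ n, IsProbabilityMeasure (μ n)] :
    ∃ M, IsProbabilityContent M ∧ Tendsto (fun n => (μ n).real) 𝒰 (𝓝 M) := by
  obtain ⟨M, hM⟩ := exists_tendsto_ultrafilter_of_mem_Icc 𝒰 (f := fun n => (μ n).real)
    (a := 0) (b := 1) fun n => ⟨fun A => measureReal_nonneg, fun A => measureReal_le_one⟩
  exact ⟨M, .of_tendsto (fun n => isProbabilityContent_real (μ n)) hM, hM⟩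

namespace IsProbabilityContent

variable {M : Set ℝ → ℝ}

theorem sub_Iic (hM : IsProbabilityContent M) {a b : ℝ} (h : a ≤ b) :
    M (Set.Iic b) - M (Set.Iic a) = M (Set.Ioc a b) := by
  rw [← Set.Iic_union_Ioc_eq_Iic h,
    hM.union measurableSet_Iic measurableSet_Ioc (Set.Iic_disjoint_Ioc le_rfl)]
  ring

theorem monotone_Iic (hM : IsProbabilityContent M) : Monotone fun x => M (Set.Iic x) :=
  fun _ _ h => hM.mono measurableSet_Iic measurableSet_Iic (Set.Iic_subset_Iic.2 h)

theorem uIoc (hM : IsProbabilityContent M) (a b : ℝ) :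
    M (Set.uIoc a b) = |M (Set.Iic b) - M (Set.Iic a)| := by
  rcases le_total a b with h | h
  · rw [Set.uIoc_of_le h, ← hM.sub_Iic h, abs_of_nonneg (sub_nonneg.2 (hM.monotone_Iic h))]
  · rw [Set.uIoc_of_ge h, ← hM.sub_Iic h, abs_sub_comm,
      abs_of_nonneg (sub_nonneg.2 (hM.monotone_Iic h))]

end IsProbabilityContent

theorem notMem_uIoc_iff {y a b : ℝ} : y ∉ Set.uIoc a b ↔ (y ≤ a ↔ y ≤ b) := by
  rw [Set.mem_uIoc]
  grind

theorem eq_of_forall_update_eq {ι α β : Type*} [Finite ι] [DecidableEq ι] (f : (ι → α) → β)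
    (r : ι → α → α → Prop)
    (h : ∀ (t : ι → α) (j : ι) (a : α), r j a (t j) → f (Function.update t j a) = f t)
    (s t : ι → α) (hst : ∀ j, r j (s j) (t j)) : f s = f t := by
  have := Fintype.ofFinite ι
  suffices ∀ A : Finset ι, f (A.piecewise s t) = f t by simpa using this Finset.univ
  intro A
  induction A using Finset.induction_on with
  | empty => simp
  | insert j A hj ih =>
    rw [Finset.piecewise_insert, h, ih]
    simpa [hj] using hst j

variable {R : RangeMap q m}

/-- Whether a point lies in a range depends only on its position relative to the entries of the
parameter. This is the consequence of monotonicity on which consistency rests. -/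
def RangeMap.IsOrderDetermined (R : RangeMap q m) : Prop :=
  ∀ ⦃y : ℝ⦄ ⦃s t : Fin q → ℝ⦄, (∀ j, y ≤ s j ↔ y ≤ t j) →
    ∀ i, y ∈ R.range s i ↔ y ∈ R.range t i

theorem cdf_dirac_eq_of_le_iff {y a b : ℝ} (h : y ≤ a ↔ y ≤ b) :
    cdf (Measure.dirac y) a = cdf (Measure.dirac y) b := by
  simp only [cdf_eq_real, measureReal_def, Measure.dirac_apply' _ measurableSet_Iic,
    Set.indicator_apply, Set.mem_Iic, h]

-- Apply the bound by the increments of `G ∘ F` to the distribution `F` concentrated at `y`.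
theorem Monotonicity.isOrderDetermined (hR : Monotonicity R) : R.IsOrderDetermined := by
  intro y s t hst i
  obtain ⟨-, G, -, hG⟩ := hR ⟨Measure.dirac y, inferInstance⟩
  rw [← eq_iff_iff]
  refine eq_of_forall_update_eq (fun t => y ∈ R.range t i) (fun _ a b => y ≤ a ↔ y ≤ b) ?_ s t hst
  intro t j a ha
  have hle := hG j i t (Function.update t j a) fun j' hj' => by simp [hj']
  simp only [ProbabilityMeasure.coe_mk, Function.update_self, cdf_dirac_eq_of_le_iff ha, sub_self,
    abs_zero, abs_nonpos_iff, measureReal_def, sub_eq_zero,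
    Measure.dirac_apply' _ (R.measurableSet_range _ _)] at hle
  by_cases hs : y ∈ R.range (Function.update t j a) i <;> by_cases ht : y ∈ R.range t i <;>
    simp_all

theorem RangeMap.IsOrderDetermined.sdiff_subset (hR : R.IsOrderDetermined) (s t : Fin q → ℝ)
    (i : Fin m) : R.range s i \ R.range t i ⊆ ⋃ j, Set.uIoc (s j) (t j) := by
  rintro y ⟨hs, ht⟩
  by_contra hy
  simp only [Set.mem_iUnion, not_exists, notMem_uIoc_iff] at hy
  exact ht ((hR hy i).1 hs)

theorem RangeMap.IsOrderDetermined.abs_sub_le (hR : R.IsOrderDetermined) {M : Set ℝ → ℝ}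
    (hM : IsProbabilityContent M) (s t : Fin q → ℝ) (i : Fin m) :
    |M (R.range s i) - M (R.range t i)| ≤ ∑ j, M (Set.uIoc (s j) (t j)) := by
  have hsub : ∀ s t : Fin q → ℝ,
      M (R.range s i) - M (R.range t i) ≤ ∑ j, M (Set.uIoc (s j) (t j)) := fun s t =>
    calc M (R.range s i) - M (R.range t i)
        ≤ M (R.range s i \ R.range t i) :=
          hM.sub_le_sdiff (R.measurableSet_range s i) (R.measurableSet_range t i)
      _ ≤ M (⋃ j, Set.uIoc (s j) (t j)) :=
          hM.mono ((R.measurableSet_range s i).diff (R.measurableSet_range t i))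
            (.iUnion fun _ => measurableSet_uIoc) (hR.sdiff_subset s t i)
      _ ≤ ∑ j, M (Set.uIoc (s j) (t j)) := hM.iUnion_fintype_le fun _ => measurableSet_uIoc
  exact abs_sub_le_iff.2 ⟨hsub s t, by simpa only [Set.uIoc_comm] using hsub t s⟩

theorem RangeMap.IsOrderDetermined.continuous (hR : R.IsOrderDetermined) {M : Set ℝ → ℝ}
    (hM : IsProbabilityContent M) (hcont : Continuous fun x => M (Set.Iic x)) (i : Fin m) :
    Continuous fun t => M (R.range t i) := by
  refine continuous_iff_continuousAt.2 fun t => tendsto_iff_dist_tendsto_zero.2 ?_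
  refine squeeze_zero (fun _ => dist_nonneg) (fun s => hR.abs_sub_le hM s t i) ?_
  have : Continuous fun s : Fin q → ℝ => ∑ j, |M (Set.Iic (t j)) - M (Set.Iic (s j))| :=
    continuous_finsetSum _ fun j _ => (continuous_const.sub (hcont.comp (continuous_apply j))).abs
  simpa [hM.uIoc] using this.tendsto t

theorem RangeMap.sum_eq_one (R : RangeMap q m) {M : Set ℝ → ℝ} (hM : IsProbabilityContent M)
    (t : Fin q → ℝ) : ∑ i, M (R.range t i) = 1 := by
  rw [← hM.iUnion_fintype (R.disjoint_range t · · ·) (R.measurableSet_range t), R.iUnion_range,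
    hM.univ]

/-- The index of the range that contains `y`. -/
def RangeMap.label (R : RangeMap q m) (t : Fin q → ℝ) (y : ℝ) : Fin m :=
  (Set.mem_iUnion.1 ((R.iUnion_range t).symm ▸ Set.mem_univ y)).choose

/-- The range observed when the parameter is `t` and the datum is `y`. -/
def RangeMap.cell (R : RangeMap q m) (t : Fin q → ℝ) (y : ℝ) : Set ℝ := R.range t (R.label t y)

theorem RangeMap.mem_cell (R : RangeMap q m) (t : Fin q → ℝ) (y : ℝ) : y ∈ R.cell t y :=
  (Set.mem_iUnion.1 ((R.iUnion_range t).symm ▸ Set.mem_univ y)).choose_spec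

theorem RangeMap.label_eq_iff (R : RangeMap q m) {t : Fin q → ℝ} {y : ℝ} {i : Fin m} :
    R.label t y = i ↔ y ∈ R.range t i := by
  refine ⟨fun h => h ▸ R.mem_cell t y, fun h => ?_⟩
  by_contra hne
  exact Set.disjoint_left.1 (R.disjoint_range t _ _ hne) (R.mem_cell t y) h

/-- The points of the `i`-th range whose position relative to the parameter is the pattern `S`,
that is, the points lying below exactly the entries with index in `S`. The integers around `y` are
used as a parameter realizing this pattern, which makes the set visibly measurable. -/
def RangeMap.patternRange (R : RangeMap q m) (S : Finset (Fin q)) (i : Fin m) : Set ℝ :=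
  {y | y ∈ R.range (fun j => if j ∈ S then (⌈y⌉ : ℝ) else ⌈y⌉ - 1) i}

theorem RangeMap.measurableSet_patternRange (R : RangeMap q m) (S : Finset (Fin q)) (i : Fin m) :
    MeasurableSet (R.patternRange S i) := by
  have : R.patternRange S i = ⋃ k : ℤ, Int.ceil ⁻¹' {k} ∩
      R.range (fun j => if j ∈ S then (k : ℝ) else k - 1) i := by
    ext y
    simp [patternRange, -Int.preimage_ceil_singleton]
  rw [this]
  exact .iUnion fun k => (Int.measurable_ceil (measurableSet_singleton k)).inter
    (R.measurableSet_range _ i)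

theorem RangeMap.IsOrderDetermined.mem_range_iff_mem_patternRange (hR : R.IsOrderDetermined)
    {t : Fin q → ℝ} {y : ℝ} {S : Finset (Fin q)} (hS : ∀ j, y ≤ t j ↔ j ∈ S) (i : Fin m) :
    y ∈ R.range t i ↔ y ∈ R.patternRange S i := by
  refine hR (fun j => ?_) i
  rw [hS j]
  split_ifs with hj
  · exact iff_of_true hj (Int.le_ceil y)
  · exact iff_of_false hj (by linarith [Int.ceil_lt_add_one y])

/-- The minimum of the entries of `t` with index in `S`; it is `⊤` for `S = ∅`. -/
def upperEnd (S : Finset (Fin q)) (t : Fin q → ℝ) : EReal := S.inf fun j => (t j : EReal)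

/-- The maximum of the entries of `t` with index outside `S`; it is `⊥` if there are none. -/
def lowerEnd (S : Finset (Fin q)) (t : Fin q → ℝ) : EReal := Sᶜ.sup fun j => (t j : EReal)

theorem continuous_upperEnd (S : Finset (Fin q)) : Continuous (upperEnd S) :=
  Continuous.finset_inf_apply fun j _ => continuous_coe_real_ereal.comp (continuous_apply j)

theorem continuous_lowerEnd (S : Finset (Fin q)) : Continuous (lowerEnd S) :=
  Continuous.finset_sup_apply fun j _ => continuous_coe_real_ereal.comp (continuous_apply j)

theorem mem_Ioc_ends_iff {S : Finset (Fin q)} {t : Fin q → ℝ} {y : ℝ} :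
    (y : EReal) ∈ Set.Ioc (lowerEnd S t) (upperEnd S t) ↔ ∀ j, y ≤ t j ↔ j ∈ S := by
  simp only [Set.mem_Ioc, lowerEnd, upperEnd, Finset.sup_lt_iff (EReal.bot_lt_coe y),
    Finset.le_inf_iff, Finset.mem_compl, EReal.coe_lt_coe_iff, EReal.coe_le_coe_iff]
  grind

theorem measurableSet_coe_preimage_Ioc (a b : EReal) :
    MeasurableSet ((↑) ⁻¹' Set.Ioc a b : Set ℝ) :=
  measurable_coe_real_ereal measurableSet_Ioc

theorem RangeMap.IsOrderDetermined.range_eq_iUnion (hR : R.IsOrderDetermined) (t : Fin q → ℝ)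
    (i : Fin m) : R.range t i =
      ⋃ S : Finset (Fin q), R.patternRange S i ∩ (↑) ⁻¹' Set.Ioc (lowerEnd S t) (upperEnd S t) := by
  ext y
  simp only [Set.mem_iUnion, Set.mem_inter_iff, Set.mem_preimage, mem_Ioc_ends_iff]
  constructor
  · intro hy
    have hS : ∀ j, y ≤ t j ↔ j ∈ ({j | y ≤ t j} : Finset (Fin q)) := by simp
    exact ⟨_, (hR.mem_range_iff_mem_patternRange hS i).1 hy, hS⟩
  · rintro ⟨S, hy, hS⟩
    exact (hR.mem_range_iff_mem_patternRange hS i).2 hy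

theorem pairwise_disjoint_coe_preimage_Ioc_ends (t : Fin q → ℝ) :
    Pairwise (Function.onFun Disjoint fun S : Finset (Fin q) =>
      ((↑) ⁻¹' Set.Ioc (lowerEnd S t) (upperEnd S t) : Set ℝ)) := by
  intro S S' hne
  refine Set.disjoint_left.2 fun y hy hy' => hne ?_
  rw [Set.mem_preimage, mem_Ioc_ends_iff] at hy hy'
  ext j
  rw [← hy j, hy' j]

theorem RangeMap.IsOrderDetermined.measurableSet_mem_range (hR : R.IsOrderDetermined) (i : Fin m) :
    MeasurableSet {x : (Fin q → ℝ) × ℝ | x.2 ∈ R.range x.1 i} := by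
  have hmeas : ∀ S : Finset (Fin q), MeasurableSet {x : (Fin q → ℝ) × ℝ |
      x.2 ∈ R.patternRange S i ∧ (x.2 : EReal) ∈ Set.Ioc (lowerEnd S x.1) (upperEnd S x.1)} := by
    intro S
    have hy : Measurable fun x : (Fin q → ℝ) × ℝ => (x.2 : EReal) := by fun_prop
    exact (measurable_snd (R.measurableSet_patternRange S i)).inter
      ((measurableSet_lt ((continuous_lowerEnd S).measurable.comp measurable_fst) hy).inter
        (measurableSet_le hy ((continuous_upperEnd S).measurable.comp measurable_fst)))
  convert MeasurableSet.iUnion hmeas using 1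
  ext x
  simp [hR.range_eq_iUnion x.1 i]

/-- The distribution function of the restriction of the content `M` to `B`, as a function on the
extended reals. -/
def restrictCdf (M : Set ℝ → ℝ) (B : Set ℝ) (x : EReal) : ℝ := M (B ∩ (↑) ⁻¹' Set.Iic x)

theorem measurableSet_inter_coe_preimage_Iic {B : Set ℝ} (hB : MeasurableSet B) (x : EReal) :
    MeasurableSet (B ∩ (↑) ⁻¹' Set.Iic x) :=
  hB.inter (measurable_coe_real_ereal measurableSet_Iic)

theorem IsProbabilityContent.monotone_restrictCdf {M : Set ℝ → ℝ} (hM : IsProbabilityContent M)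
    {B : Set ℝ} (hB : MeasurableSet B) : Monotone (restrictCdf M B) := fun x y hxy =>
  hM.mono (measurableSet_inter_coe_preimage_Iic hB x) (measurableSet_inter_coe_preimage_Iic hB y)
    (Set.inter_subset_inter_right _ (Set.preimage_mono (Set.Iic_subset_Iic.2 hxy)))

theorem IsProbabilityContent.inter_coe_preimage_Ioc {M : Set ℝ → ℝ} (hM : IsProbabilityContent M)
    {B : Set ℝ} (hB : MeasurableSet B) (a b : EReal) :
    M (B ∩ (↑) ⁻¹' Set.Ioc a b) = restrictCdf M B b - restrictCdf M B (a ⊓ b) := by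
  rw [restrictCdf, restrictCdf, eq_sub_iff_add_eq',
    ← hM.union (measurableSet_inter_coe_preimage_Iic hB _)
      (hB.inter (measurableSet_coe_preimage_Ioc a b)),
    ← Set.inter_union_distrib_left, ← Set.preimage_union]
  · congr 3
    ext x
    simp only [Set.mem_union, Set.mem_Iic, Set.mem_Ioc, le_inf_iff]
    grind
  · refine Set.disjoint_left.2 fun y hy hy' => ?_
    exact hy'.2.1.not_ge (hy.2.trans inf_le_left)

theorem RangeMap.IsOrderDetermined.eq_sum_restrictCdf (hR : R.IsOrderDetermined) {M : Set ℝ → ℝ}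
    (hM : IsProbabilityContent M) (t : Fin q → ℝ) (i : Fin m) :
    M (R.range t i) = ∑ S, (restrictCdf M (R.patternRange S i) (upperEnd S t) -
      restrictCdf M (R.patternRange S i) (lowerEnd S t ⊓ upperEnd S t)) := by
  rw [hR.range_eq_iUnion t i, hM.iUnion_fintype]
  · simp only [hM.inter_coe_preimage_Ioc (R.measurableSet_patternRange _ i)]
  · exact fun S S' hne => (pairwise_disjoint_coe_preimage_Ioc_ends t hne).mono
      Set.inter_subset_right Set.inter_subset_right
  · exact fun S => (R.measurableSet_patternRange S i).inter (measurableSet_coe_preimage_Ioc _ _)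

theorem RangeMap.IsOrderDetermined.measurable (hR : R.IsOrderDetermined) {M : Set ℝ → ℝ}
    (hM : IsProbabilityContent M) (i : Fin m) : Measurable fun t => M (R.range t i) := by
  simp only [hR.eq_sum_restrictCdf hM]
  refine Finset.measurable_sum _ fun S _ => ?_
  have hmono := (hM.monotone_restrictCdf (R.measurableSet_patternRange S i)).measurable
  exact (hmono.comp (continuous_upperEnd S).measurable).sub
    (hmono.comp ((continuous_lowerEnd S).inf (continuous_upperEnd S)).measurable)

/-- The jumps `c` of `f`: the differences between a limit of `f` at a point, taken along an
ultrafilter, and the value of `f` at this point. -/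
def jumps {X : Type*} [TopologicalSpace X] (f : X → ℝ) : Set ℝ :=
  {c | ∃ (x : X) (𝒱 : Ultrafilter X), ↑𝒱 ≤ 𝓝 x ∧ Tendsto f 𝒱 (𝓝 (f x + c))}

theorem le_nhdsLT_or_le_pure_or_le_nhdsGT {X : Type*} [TopologicalSpace X] [LinearOrder X] {x : X}
    {𝒱 : Ultrafilter X} (h : ↑𝒱 ≤ 𝓝 x) :
    (𝒱 : Filter X) ≤ 𝓝[<] x ∨ (𝒱 : Filter X) ≤ pure x ∨ (𝒱 : Filter X) ≤ 𝓝[>] x := by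
  have huniv : Set.Iio x ∪ ({x} ∪ Set.Ioi x) ∈ 𝒱 := by
    rw [show Set.Iio x ∪ ({x} ∪ Set.Ioi x) = Set.univ from
      Set.eq_univ_of_forall fun y => lt_trichotomy y x]
    exact Filter.univ_mem
  rw [Ultrafilter.union_mem_iff, Ultrafilter.union_mem_iff] at huniv
  simpa only [nhdsWithin, le_inf_iff, h, true_and, le_principal_iff, Ultrafilter.mem_coe,
    ← Filter.principal_singleton] using huniv

theorem countable_jumps_of_monotone {X : Type*} [TopologicalSpace X] [LinearOrder X]
    [OrderTopology X] [SecondCountableTopology X] {f : X → ℝ} (hf : Monotone f) :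
    (jumps f).Countable := by
  have hcount : (⋃ x ∈ {x | ¬ContinuousAt f x},
      {f.leftLim x - f x, f.rightLim x - f x} : Set ℝ).Countable :=
    hf.countable_not_continuousAt.biUnion fun x _ => (Set.toFinite _).countable
  refine (hcount.insert 0).mono ?_
  rintro c ⟨x, 𝒱, hx, hc⟩
  have hlim : ∀ l : ℝ, Tendsto f 𝒱 (𝓝 l) → c = l - f x := fun l hl => by
    rw [← tendsto_nhds_unique hc hl, add_sub_cancel_left]
  by_cases hcont : ContinuousAt f x
  · exact Or.inl (by simpa using hlim _ (hcont.mono_left hx))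
  rcases le_nhdsLT_or_le_pure_or_le_nhdsGT hx with hlt | heq | hgt
  · exact Or.inr (Set.mem_biUnion hcont (Or.inl (hlim _ ((hf.tendsto_leftLim x).mono_left hlt))))
  · exact Or.inl (by simpa using hlim _ ((tendsto_pure_nhds f x).mono_left heq))
  · exact Or.inr (Set.mem_biUnion hcont (Or.inr (hlim _ ((hf.tendsto_rightLim x).mono_left hgt))))

theorem jumps_comp_subset {X Z : Type*} [TopologicalSpace X] [TopologicalSpace Z] {g : Z → X}
    (hg : Continuous g) (f : X → ℝ) : jumps (fun z => f (g z)) ⊆ jumps f := by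
  rintro c ⟨z, 𝒱, hz, hc⟩
  exact ⟨g z, 𝒱.map g, (map_mono hz).trans (hg.tendsto z), hc⟩

theorem jumps_sum_subset {ι X : Type*} [Fintype ι] [TopologicalSpace X] {f : ι → X → ℝ} {a b : ℝ}
    (hf : ∀ i x, f i x ∈ Set.Icc a b) :
    jumps (fun x => ∑ i, f i x) ⊆
      (fun c : ι → ℝ => ∑ i, c i) '' Set.pi Set.univ fun i => jumps (f i) := by
  rintro c ⟨x, 𝒱, hx, hc⟩
  choose l hl using fun i => exists_tendsto_ultrafilter_of_mem_Icc 𝒱 (hf i)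
  refine ⟨fun i => l i - f i x, fun i _ => ⟨x, 𝒱, hx, by simpa using hl i⟩, ?_⟩
  dsimp only
  rw [Finset.sum_sub_distrib, ← tendsto_nhds_unique hc (tendsto_finsetSum _ fun i _ => hl i),
    add_sub_cancel_left]

theorem countable_jumps_sum {ι X : Type*} [Fintype ι] [TopologicalSpace X] {f : ι → X → ℝ}
    {a b : ℝ} (hf : ∀ i x, f i x ∈ Set.Icc a b) (hc : ∀ i, (jumps (f i)).Countable) :
    (jumps fun x => ∑ i, f i x).Countable :=
  ((Set.countable_univ_pi hc).image _).mono (jumps_sum_subset hf)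

theorem jumps_sub_subset {X : Type*} [TopologicalSpace X] {f g : X → ℝ} {a b : ℝ}
    (hf : ∀ x, f x ∈ Set.Icc a b) :
    jumps (fun x => f x - g x) ⊆ Set.image2 (· - ·) (jumps f) (jumps g) := by
  rintro c ⟨x, 𝒱, hx, hc⟩
  obtain ⟨l, hl⟩ := exists_tendsto_ultrafilter_of_mem_Icc 𝒱 hf
  refine ⟨l - f x, ⟨x, 𝒱, hx, by simpa using hl⟩, l - f x - c, ⟨x, 𝒱, hx, ?_⟩, by simp⟩
  convert hl.sub hc using 2
  · simp
  · ring

theorem inf_ae_neBot_of_mem_support {X : Type*} [TopologicalSpace X] [MeasurableSpace X]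
    {μ : Measure X} {x : X} (hx : x ∈ μ.support) : (𝓝 x ⊓ ae μ).NeBot := by
  refine inf_neBot_iff.2 fun {U} hU {V} hV => ?_
  by_contra hUV
  rw [Set.not_nonempty_iff_eq_empty, ← Set.disjoint_iff_inter_eq_empty] at hUV
  exact ((Measure.mem_support_iff_forall x).1 hx U hU).ne'
    (measure_mono_null hUV.subset_compl_right hV)

theorem image_sub_support_subset_jumps {X : Type*} [TopologicalSpace X] [MeasurableSpace X]
    {μ : Measure X} {f g : X → ℝ} (hg : Continuous g) (hfg : f =ᵐ[μ] g) :
    (fun x => g x - f x) '' μ.support ⊆ jumps f := by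
  rintro _ ⟨x, hx, rfl⟩
  have := inf_ae_neBot_of_mem_support hx
  refine ⟨x, .of (𝓝 x ⊓ ae μ), (Ultrafilter.of_le _).trans inf_le_left, ?_⟩
  rw [add_sub_cancel]
  exact ((hg.tendsto x).mono_left inf_le_left).congr'
    (hfg.symm.filter_mono inf_le_right) |>.mono_left (Ultrafilter.of_le _)

theorem IsProbabilityContent.restrictCdf_mem_Icc {M : Set ℝ → ℝ} (hM : IsProbabilityContent M)
    {B : Set ℝ} (hB : MeasurableSet B) (x : EReal) : restrictCdf M B x ∈ Set.Icc (0 : ℝ) 1 :=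
  ⟨hM.nonneg _, hM.le_one (measurableSet_inter_coe_preimage_Iic hB x)⟩

theorem RangeMap.IsOrderDetermined.countable_jumps (hR : R.IsOrderDetermined) {M : Set ℝ → ℝ}
    (hM : IsProbabilityContent M) (i : Fin m) : (jumps fun t => M (R.range t i)).Countable := by
  simp only [hR.eq_sum_restrictCdf hM]
  have hB := fun S => R.measurableSet_patternRange S i
  have hmem := fun S => hM.restrictCdf_mem_Icc (hB S)
  have hcount := fun S => countable_jumps_of_monotone (hM.monotone_restrictCdf (hB S))
  refine countable_jumps_sum (a := -1) (b := 1) (fun S t => ?_) fun S => ?_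
  · exact abs_le.1 (abs_sub_le_of_nonneg_of_le (hmem S _).1 (hmem S _).2 (hmem S _).1 (hmem S _).2)
  · refine Set.Countable.mono (jumps_sub_subset fun t => hmem S _) (.image2 ?_ ?_ _)
    · exact (hcount S).mono (jumps_comp_subset (continuous_upperEnd S) (restrictCdf M _))
    · exact (hcount S).mono
        (jumps_comp_subset ((continuous_lowerEnd S).inf (continuous_upperEnd S)) (restrictCdf M _))

section RealFunctions

variable {Φ F : ℝ → ℝ}

-- `Φ - F` only jumps upwards, so it cannot skip `v` on its way down.
theorem exists_sub_eq_of_monotone_of_continuous (hΦ : Monotone Φ) (hF : Continuous F) {a b v : ℝ}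
    (hab : a ≤ b) (ha : v < Φ a - F a) (hb : Φ b - F b ≤ v) :
    ∃ z ∈ Set.Ioc a b, Φ z - F z = v := by
  set S : Set ℝ := {x ∈ Set.Icc a b | Φ x - F x ≤ v}
  have hbS : b ∈ S := ⟨⟨hab, le_rfl⟩, hb⟩
  have hbdd : BddBelow S := ⟨a, fun x hx => hx.1.1⟩
  have hlim : ∀ T, Tendsto (fun x => v + F x) (𝓝[T] sInf S) (𝓝 (v + F (sInf S))) := fun T =>
    ((hF.tendsto _).const_add v).mono_left nhdsWithin_le_nhds
  have hle : Φ (sInf S) ≤ v + F (sInf S) := by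
    have : (𝓝[S] sInf S).NeBot :=
      mem_closure_iff_nhdsWithin_neBot.1 (csInf_mem_closure ⟨b, hbS⟩ hbdd)
    refine ge_of_tendsto (hlim S) (eventually_nhdsWithin_of_forall fun x hx => ?_)
    linarith [hΦ (csInf_le hbdd hx), hx.2]
  have hab' : a < sInf S := by
    refine (le_csInf ⟨b, hbS⟩ fun x hx => hx.1.1).lt_of_ne fun h => ?_
    rw [← h] at hle
    linarith
  have hge : v + F (sInf S) ≤ Φ (sInf S) := by
    refine le_of_tendsto (hlim _) (mem_of_superset (Ioo_mem_nhdsLT hab') fun x hx => ?_)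
    have hx' : v < Φ x - F x := lt_of_not_ge fun h =>
      notMem_of_lt_csInf hx.2 hbdd ⟨⟨hx.1.le, hx.2.le.trans (csInf_le hbdd hbS)⟩, h⟩
    exact (by linarith : v + F x ≤ Φ x).trans (hΦ hx.2.le)
  exact ⟨sInf S, ⟨hab', csInf_le hbdd hbS⟩, by linarith⟩

theorem sub_le_sub_of_countable_image (hΦ : Monotone Φ) (hF : Continuous F) {a b : ℝ}
    (hab : a ≤ b) (hC : ((fun x => Φ x - F x) '' Set.Ioc a b).Countable) :
    Φ a - F a ≤ Φ b - F b := by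
  by_contra! hlt
  obtain ⟨v, hvC, hbv, hva⟩ := (hC.dense_compl ℝ).exists_between hlt
  obtain ⟨z, hz, hzv⟩ := exists_sub_eq_of_monotone_of_continuous hΦ hF hab hva hbv.le
  exact hvC ⟨z, hz, hzv⟩

theorem monotone_of_forall_exists_monotoneOn {g : ℝ → ℝ} (h : ∀ x, ∃ U ∈ 𝓝 x, MonotoneOn g U) :
    Monotone g := by
  intro a b hab
  choose U hU hmono using h
  obtain ⟨t, ht0, htm, ⟨n, hn⟩, hsub⟩ := exists_monotone_Icc_subset_open_cover_Icc hab
    (c := fun x : ℝ => ((↑) : Set.Icc a b → ℝ) ⁻¹' interior (U x))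
    (fun x => isOpen_interior.preimage continuous_subtype_val)
    (fun x _ => Set.mem_iUnion.2 ⟨x.1, mem_interior_iff_mem_nhds.2 (hU x.1)⟩)
  have hstep : ∀ k, g (t k) ≤ g (t (k + 1)) := fun k => by
    obtain ⟨x, hx⟩ := hsub k
    have hle := htm (Nat.le_succ k)
    exact hmono x (interior_subset (hx ⟨le_rfl, hle⟩)) (interior_subset (hx ⟨hle, le_rfl⟩)) hle
  have hgn : g (t 0) ≤ g (t n) := monotone_nat_of_le_succ (f := fun k => g (t k)) hstep n.zero_le
  rwa [ht0, hn n le_rfl] at hgn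

theorem eq_of_monotone_sub (h0 : ∀ x, 0 ≤ Φ x) (h1 : ∀ x, Φ x ≤ 1)
    (hbot : Tendsto F atBot (𝓝 0)) (htop : Tendsto F atTop (𝓝 1))
    (hmono : Monotone fun x => Φ x - F x) : Φ = F := by
  ext x
  have hle : Φ x - F x ≤ 1 - 1 := by
    refine ge_of_tendsto (htop.const_sub 1) ((eventually_ge_atTop x).mono fun z hz => ?_)
    exact (hmono hz).trans (sub_le_sub_right (h1 z) _)
  have hge : 0 - 0 ≤ Φ x - F x := by
    refine le_of_tendsto (hbot.const_sub 0) ((eventually_le_atBot x).mono fun z hz => ?_)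
    exact (sub_le_sub_right (h0 z) _).trans (hmono hz)
  linarith

end RealFunctions

/-- Every small interval `(a, b]` around a point of the closure of `𝒴` is the difference of two
ranges with parameters in the support of `PT`. -/
def LocallyResolvable (𝒴 : Set ℝ) (R : RangeMap q m) (PT : Measure (Fin q → ℝ)) : Prop :=
  ∀ y ∈ closure 𝒴, ∃ N : Set ℝ, IsOpen N ∧ y ∈ N ∧ ∀ a ∈ N, ∀ b ∈ N,
    ∃ t ∈ PT.support, ∃ t' ∈ PT.support, ∃ k l : Fin m,
      Set.Ioc a b ∩ R.range t k = ∅ ∧ Set.Ioc a b ∪ R.range t k = R.range t' l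

theorem monotoneOn_sub_of_resolved {S : Set (Fin q → ℝ)} {N : Set ℝ} (hN : N.OrdConnected)
    (hres : ∀ a ∈ N, ∀ b ∈ N, ∃ t ∈ S, ∃ t' ∈ S, ∃ k l : Fin m,
      Set.Ioc a b ∩ R.range t k = ∅ ∧ Set.Ioc a b ∪ R.range t k = R.range t' l)
    {M Q : Set ℝ → ℝ} (hM : IsProbabilityContent M) (hQ : IsProbabilityContent Q)
    (hcont : Continuous fun x => Q (Set.Iic x))
    (hcount : ∀ i, ((fun t => Q (R.range t i) - M (R.range t i)) '' S).Countable) :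
    MonotoneOn (fun x => M (Set.Iic x) - Q (Set.Iic x)) N := by
  intro a ha b hb hab
  refine sub_le_sub_of_countable_image hM.monotone_Iic hcont hab ?_
  have hE := Set.countable_iUnion hcount
  refine ((hE.image2 hE (· - ·)).image (M (Set.Iic a) - Q (Set.Iic a) + ·)).mono ?_
  rintro _ ⟨x, hx, rfl⟩
  obtain ⟨t, ht, t', ht', k, l, hdisj, hunion⟩ := hres a ha x (hN.out ha hb ⟨hx.1.le, hx.2⟩)
  have hadd : ∀ {L : Set ℝ → ℝ}, IsProbabilityContent L →
      L (R.range t' l) = L (Set.Iic x) - L (Set.Iic a) + L (R.range t k) := fun hL => by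
    rw [← hunion, hL.sub_Iic hx.1.le]
    exact hL.union measurableSet_Ioc (R.measurableSet_range t k)
      (Set.disjoint_iff_inter_eq_empty.2 hdisj)
  refine ⟨_, ⟨_, Set.mem_iUnion.2 ⟨k, t, ht, rfl⟩, _, Set.mem_iUnion.2 ⟨l, t', ht', rfl⟩, rfl⟩, ?_⟩
  simp only [hadd hM, hadd hQ]
  ring

theorem monotoneOn_sub_cdf_of_disjoint {𝒴 N : Set ℝ} (hN : N.OrdConnected) {PY : Measure ℝ}
    [IsProbabilityMeasure PY] (h𝒴 : ∀ᵐ y ∂PY, y ∈ 𝒴) (hdisj : Disjoint N 𝒴) {Φ : ℝ → ℝ}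
    (hΦ : Monotone Φ) : MonotoneOn (fun x => Φ x - PY.real (Set.Iic x)) N := by
  intro a ha b hb hab
  have hzero : PY.real (Set.Ioc a b) = 0 := by
    refine (measureReal_eq_zero_iff).2 (measure_mono_null (fun y hy => ?_) h𝒴)
    exact Set.disjoint_left.1 hdisj (hN.out ha hb (Set.Ioc_subset_Icc_self hy))
  rw [← (isProbabilityContent_real PY).sub_Iic hab, sub_eq_zero] at hzero
  simp only [hzero]
  exact sub_le_sub_right (hΦ hab) _

theorem LocallyResolvable.eq_cdf_of_ae_eq {𝒴 : Set ℝ} {PT : Measure (Fin q → ℝ)}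
    (hres : LocallyResolvable 𝒴 R PT) (hR : R.IsOrderDetermined) {PY : Measure ℝ}
    [IsProbabilityMeasure PY] (hcont : Continuous (cdf PY)) (h𝒴 : ∀ᵐ y ∂PY, y ∈ 𝒴)
    {M : Set ℝ → ℝ} (hM : IsProbabilityContent M)
    (hae : ∀ i, (fun t => M (R.range t i)) =ᵐ[PT] fun t => PY.real (R.range t i)) (x : ℝ) :
    M (Set.Iic x) = cdf PY x := by
  have hPY := isProbabilityContent_real PY
  have hIic : Continuous fun x => PY.real (Set.Iic x) := funext (cdf_eq_real PY) ▸ hcont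
  have hcount : ∀ i, ((fun t => PY.real (R.range t i) - M (R.range t i)) '' PT.support).Countable :=
    fun i => (hR.countable_jumps hM i).mono
      (image_sub_support_subset_jumps (hR.continuous hPY hIic i) (hae i))
  have hmono : Monotone fun x => M (Set.Iic x) - PY.real (Set.Iic x) := by
    refine monotone_of_forall_exists_monotoneOn fun y => ?_
    by_cases hy : y ∈ closure 𝒴
    · obtain ⟨N, hN, hyN, hNres⟩ := hres y hy
      obtain ⟨a, b, hyab, hab⟩ := mem_nhds_iff_exists_Ioo_subset.1 (hN.mem_nhds hyN)
      exact ⟨Set.Ioo a b, Ioo_mem_nhds hyab.1 hyab.2,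
        monotoneOn_sub_of_resolved Set.ordConnected_Ioo
          (fun a ha b hb => hNres a (hab ha) b (hab hb)) hM hPY hIic hcount⟩
    · obtain ⟨a, b, hyab, hab⟩ :=
        mem_nhds_iff_exists_Ioo_subset.1 (isClosed_closure.isOpen_compl.mem_nhds hy)
      exact ⟨Set.Ioo a b, Ioo_mem_nhds hyab.1 hyab.2, monotoneOn_sub_cdf_of_disjoint
        Set.ordConnected_Ioo h𝒴 (Set.disjoint_left.2 fun y hy hy' => hab hy (subset_closure hy'))
        hM.monotone_Iic⟩
  have heq := eq_of_monotone_sub (F := cdf PY) (fun x => hM.nonneg (Set.Iic x))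
    (fun x => hM.le_one measurableSet_Iic) (tendsto_cdf_atBot PY) (tendsto_cdf_atTop PY)
    (by simpa only [cdf_eq_real] using hmono)
  exact congrFun heq x

theorem coe_ereal_sum {ι : Type*} (s : Finset ι) (f : ι → ℝ) :
    ((∑ j ∈ s, f j : ℝ) : EReal) = ∑ j ∈ s, (f j : EReal) :=
  map_sum (⟨⟨Real.toEReal, EReal.coe_zero⟩, EReal.coe_add⟩ : ℝ →+ EReal) f s

theorem logLikelihood_eq_sum (R : RangeMap q m) {n : ℕ} (T : Fin n → Fin q → ℝ) (Y : Fin n → ℝ)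
    (F : ProbabilityMeasure ℝ) : logLikelihood R T Y F =
      (((n : ℝ)⁻¹ : ℝ) : EReal) * ∑ j, ENNReal.log ((F : Measure ℝ) (R.cell (T j) (Y j))) := by
  rw [logLikelihood]
  congr 1
  refine Finset.sum_congr rfl fun j _ => ?_
  rw [Finset.sum_eq_single_of_mem (R.label (T j) (Y j)) (Finset.mem_univ _)
    fun i _ hi => Set.indicator_of_notMem (fun h => hi (R.label_eq_iff.2 h).symm) _]
  exact Set.indicator_of_mem (R.mem_cell _ _) _

theorem logLikelihood_eq_coe {n : ℕ} {T : Fin n → Fin q → ℝ} {Y : Fin n → ℝ}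
    {F : ProbabilityMeasure ℝ} (hpos : ∀ j, 0 < (F : Measure ℝ).real (R.cell (T j) (Y j))) :
    logLikelihood R T Y F =
      (((n : ℝ)⁻¹ * ∑ j, Real.log ((F : Measure ℝ).real (R.cell (T j) (Y j))) : ℝ) : EReal) := by
  rw [logLikelihood_eq_sum, EReal.coe_mul, coe_ereal_sum]
  congr 1
  refine Finset.sum_congr rfl fun j _ => ?_
  rw [← ENNReal.log_ofReal_of_pos (hpos j), ofReal_measureReal]

theorem logLikelihood_eq_bot {n : ℕ} {T : Fin n → Fin q → ℝ} {Y : Fin n → ℝ}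
    {F : ProbabilityMeasure ℝ} {j : Fin n} (hj : (F : Measure ℝ) (R.cell (T j) (Y j)) = 0) :
    logLikelihood R T Y F = ⊥ := by
  have hn : (0 : ℝ) < n := Nat.cast_pos.2 j.pos
  rw [logLikelihood_eq_sum, ← Finset.add_sum_erase _ _ (Finset.mem_univ j), hj, ENNReal.log_zero,
    EReal.bot_add, EReal.coe_mul_bot_of_pos (inv_pos.2 hn)]

theorem sum_div_le_card_of_sum_log_le {ι : Type*} [Fintype ι] {p r : ι → ℝ} (hp : ∀ j, 0 < p j)
    (hr : ∀ j, 0 < r j) (h : ∀ ε ∈ Set.Ioo (0 : ℝ) 1,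
      ∑ j, Real.log ((1 - ε) * r j + ε * p j) ≤ ∑ j, Real.log (r j)) :
    ∑ j, p j / r j ≤ Fintype.card ι := by
  have hderiv : ∀ ε ∈ Set.Ioo (0 : ℝ) 1, ∑ j, (p j - r j) / ((1 - ε) * r j + ε * p j) ≤ 0 := by
    intro ε hε
    have hpos : ∀ j, 0 < (1 - ε) * r j + ε * p j := fun j =>
      add_pos (mul_pos (sub_pos.2 hε.2) (hr j)) (mul_pos hε.1 (hp j))
    refine nonpos_of_mul_nonpos_right (a := ε) ?_ hε.1
    calc ε * ∑ j, (p j - r j) / ((1 - ε) * r j + ε * p j)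
        = ∑ j, (1 - (((1 - ε) * r j + ε * p j) / r j)⁻¹) := by
          rw [Finset.mul_sum]
          refine Finset.sum_congr rfl fun j _ => ?_
          have := (hr j).ne'
          rw [inv_div, one_sub_div (hpos j).ne']
          ring
      _ ≤ ∑ j, Real.log (((1 - ε) * r j + ε * p j) / r j) :=
          Finset.sum_le_sum fun j _ => Real.one_sub_inv_le_log_of_pos (div_pos (hpos j) (hr j))
      _ = ∑ j, Real.log ((1 - ε) * r j + ε * p j) - ∑ j, Real.log (r j) := by
          rw [← Finset.sum_sub_distrib]
          exact Finset.sum_congr rfl fun j _ => Real.log_div (hpos j).ne' (hr j).ne'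
      _ ≤ 0 := sub_nonpos.2 (h ε hε)
  have hlim : ContinuousAt (fun ε : ℝ => ∑ j, (p j - r j) / ((1 - ε) * r j + ε * p j)) 0 :=
    tendsto_finsetSum _ fun j _ => ContinuousAt.div (f := fun _ : ℝ => p j - r j)
      (g := fun ε : ℝ => (1 - ε) * r j + ε * p j) (by fun_prop) (by fun_prop) (by simp [(hr j).ne'])
  have hle : ∑ j, (p j - r j) / r j ≤ 0 := by
    refine le_of_tendsto (by simpa using hlim.tendsto.mono_left nhdsWithin_le_nhds)
      (eventually_of_mem (Ioo_mem_nhdsGT zero_lt_one) hderiv)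
  simpa [sub_div, (hr _).ne'] using hle

/-- The mixture that draws from `G` with probability `ε` and from `F` otherwise. -/
def mixture (F G : ProbabilityMeasure ℝ) (ε : unitInterval) : ProbabilityMeasure ℝ :=
  ⟨unitInterval.toNNReal ε • (G : Measure ℝ) +
    unitInterval.toNNReal (unitInterval.symm ε) • (F : Measure ℝ), inferInstance⟩

theorem real_mixture (F G : ProbabilityMeasure ℝ) (ε : unitInterval) (A : Set ℝ) :
    (mixture F G ε : Measure ℝ).real A =
      (1 - ε) * (F : Measure ℝ).real A + ε * (G : Measure ℝ).real A := by
  simp only [mixture, ProbabilityMeasure.coe_mk]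
  rw [measureReal_add_apply, measureReal_nnreal_smul_apply, measureReal_nnreal_smul_apply, add_comm]
  rfl

theorem IsDistributionOn.mixture {𝒴 : Set ℝ} {F G : ProbabilityMeasure ℝ}
    (hF : IsDistributionOn 𝒴 F) (hG : IsDistributionOn 𝒴 G) (ε : unitInterval) :
    IsDistributionOn 𝒴 (mixture F G ε) :=
  ae_add_measure_iff.2 ⟨Measure.ae_smul_measure hG _, Measure.ae_smul_measure hF _⟩

namespace IsNPMLE

variable {𝒴 : Set ℝ} {n : ℕ} {T : Fin n → Fin q → ℝ} {Y : Fin n → ℝ} {F Fhat : ProbabilityMeasure ℝ}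

theorem real_cell_pos (h : IsNPMLE 𝒴 R T Y Fhat) (hF : IsDistributionOn 𝒴 F)
    (hpos : ∀ j, 0 < (F : Measure ℝ).real (R.cell (T j) (Y j))) (j : Fin n) :
    0 < (Fhat : Measure ℝ).real (R.cell (T j) (Y j)) := by
  refine measureReal_nonneg.lt_of_ne' fun hzero => ?_
  have hle := h.2 F hF
  rw [logLikelihood_eq_bot ((measureReal_eq_zero_iff).1 hzero), logLikelihood_eq_coe hpos,
    le_bot_iff] at hle
  exact EReal.coe_ne_bot _ hle

theorem sum_log_le (h : IsNPMLE 𝒴 R T Y Fhat) (hF : IsDistributionOn 𝒴 F)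
    (hpos : ∀ j, 0 < (F : Measure ℝ).real (R.cell (T j) (Y j))) :
    ∑ j, Real.log ((F : Measure ℝ).real (R.cell (T j) (Y j))) ≤
      ∑ j, Real.log ((Fhat : Measure ℝ).real (R.cell (T j) (Y j))) := by
  rcases n.eq_zero_or_pos with rfl | hn
  · simp
  have hle := h.2 F hF
  rw [logLikelihood_eq_coe hpos, logLikelihood_eq_coe (h.real_cell_pos hF hpos),
    EReal.coe_le_coe_iff] at hle
  exact le_of_mul_le_mul_left hle (inv_pos.2 (Nat.cast_pos.2 hn))

-- Compare the maximizer with its mixtures with `F`: this is the first-order condition.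
theorem sum_div_le (h : IsNPMLE 𝒴 R T Y Fhat) (hF : IsDistributionOn 𝒴 F)
    (hpos : ∀ j, 0 < (F : Measure ℝ).real (R.cell (T j) (Y j))) :
    ∑ j, (F : Measure ℝ).real (R.cell (T j) (Y j)) /
      (Fhat : Measure ℝ).real (R.cell (T j) (Y j)) ≤ n := by
  have hpos' := h.real_cell_pos hF hpos
  refine (sum_div_le_card_of_sum_log_le hpos hpos' fun ε hε => ?_).trans_eq (by simp)
  have hmix : ∀ j, (mixture Fhat F ⟨ε, hε.1.le, hε.2.le⟩ : Measure ℝ).real (R.cell (T j) (Y j)) =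
      (1 - ε) * (Fhat : Measure ℝ).real (R.cell (T j) (Y j)) +
        ε * (F : Measure ℝ).real (R.cell (T j) (Y j)) := fun j => real_mixture _ _ _ _
  simp only [← hmix]
  refine h.sum_log_le (h.1.mixture hF _) fun j => ?_
  rw [hmix j]
  exact add_pos (mul_pos (sub_pos.2 hε.2) (hpos' j)) (mul_pos hε.1 (hpos j))

end IsNPMLE

theorem exists_mem_Icc_subset_of_isCompact {S C : Set ℝ} (hS : S.Nontrivial) (hC : IsCompact C)
    (h : C ⊆ S) : ∃ a ∈ S, ∃ b ∈ S, a < b ∧ C ⊆ Set.Icc a b := by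
  obtain ⟨x, hx, y, hy, hxy⟩ := hS.exists_lt
  have hC' : IsCompact (insert x (insert y C)) := (hC.insert y).insert x
  have hsub : insert x (insert y C) ⊆ S := Set.insert_subset hx (Set.insert_subset hy h)
  have hIcc := subset_Icc_csInf_csSup hC'.bddBelow hC'.bddAbove
  have hne := Set.insert_nonempty x (insert y C)
  exact ⟨_, hsub (hC'.sInf_mem hne), _, hsub (hC'.sSup_mem hne),
    (hIcc (Set.mem_insert _ _)).1.trans_lt (hxy.trans_le (hIcc (by simp)).2),
    fun z hz => hIcc (by simp [hz])⟩

theorem measure_le_of_forall_Icc_le {ν : Measure ℝ} [ν.InnerRegularCompactLTTop] [IsFiniteMeasure ν]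
    {S : Set ℝ} (hS : MeasurableSet S) (hne : S.Nontrivial) {c : ℝ≥0∞}
    (h : ∀ a ∈ S, ∀ b ∈ S, a < b → ν (Set.Icc a b) ≤ c) : ν S ≤ c := by
  rw [hS.measure_eq_iSup_isCompact_of_ne_top (measure_ne_top ν S)]
  refine iSup₂_le fun C hCS => iSup_le fun hC => ?_
  obtain ⟨a, ha, b, hb, hab, hsub⟩ := exists_mem_Icc_subset_of_isCompact hne hC hCS
  exact (measure_mono hsub).trans (h a ha b hb hab)

/-- The points of `S` that have a smaller point in `S`. For an interval `S` this is the union of the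
half-open intervals with both endpoints in `S`. -/
def core (S : Set ℝ) : Set ℝ := S \ lowerBounds S

theorem uIoc_subset_core {S : Set ℝ} (hS : S.OrdConnected) {x y : ℝ} (hx : x ∈ S) (hy : y ∈ S) :
    Set.uIoc x y ⊆ core S := by
  intro z hz
  have hmin : min x y ∈ S := by grind
  exact ⟨hS.uIcc_subset hx hy (Set.uIoc_subset_uIcc hz), fun h => (h hmin).not_gt hz.1⟩

theorem measurableSet_core {S : Set ℝ} (hS : S.OrdConnected) : MeasurableSet (core S) :=
  have hlower : IsLowerSet (lowerBounds S) := fun _ _ hba ha _ hx => hba.trans (ha hx)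
  hS.measurableSet.diff hlower.ordConnected.measurableSet

theorem core_eq_empty {S : Set ℝ} (hS : S.Subsingleton) : core S = ∅ :=
  Set.sdiff_eq_empty.2 fun _ hx _ hy => (hS hx hy).le

theorem floor_mul_real_lt (ν : Measure ℝ) [IsProbabilityMeasure ν] (K : ℕ) (A : Set ℝ) :
    ⌊K * ν.real A⌋₊ < K + 1 :=
  Nat.lt_add_one_of_le <|
    Nat.floor_le_of_le (mul_le_of_le_one_right K.cast_nonneg measureReal_le_one)

theorem monotone_floor_mul_real (ν : Measure ℝ) [IsProbabilityMeasure ν] (K : ℕ) :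
    Monotone fun A => ⌊K * ν.real A⌋₊ := fun _ _ h =>
  Nat.floor_mono (mul_le_mul_of_nonneg_left (measureReal_mono h) K.cast_nonneg)

/-- The index of `x` in a division of the line into blocks that have `ν`-mass at most `1 / K` or
consist of a single point. Recording both one-sided values of the distribution function isolates the
heavier atoms in blocks of their own. -/
def quantileIndex (ν : Measure ℝ) [IsProbabilityMeasure ν] (K : ℕ) (x : ℝ) :
    Fin (K + 1) × Fin (K + 1) :=
  (⟨⌊K * ν.real (Set.Iic x)⌋₊, floor_mul_real_lt ν K _⟩,
    ⟨⌊K * ν.real (Set.Iio x)⌋₊, floor_mul_real_lt ν K _⟩)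

section Quantile

variable (ν : Measure ℝ) [IsProbabilityMeasure ν] (K : ℕ)

theorem monotone_quantileIndex : Monotone (quantileIndex ν K) := fun _ _ h =>
  ⟨Fin.mk_le_mk.2 (monotone_floor_mul_real ν K (Set.Iic_subset_Iic.2 h)),
    Fin.mk_le_mk.2 (monotone_floor_mul_real ν K (Set.Iio_subset_Iio h))⟩

theorem ordConnected_quantileIndex_preimage (k : Fin (K + 1) × Fin (K + 1)) :
    (quantileIndex ν K ⁻¹' {k}).OrdConnected :=
  Set.ordConnected_singleton.preimage_mono (monotone_quantileIndex ν K)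

theorem measurable_quantileIndex : Measurable (quantileIndex ν K) :=
  measurable_to_countable' fun k => (ordConnected_quantileIndex_preimage ν K k).measurableSet

variable {ν K}

theorem real_Icc_le_of_quantileIndex_eq (hK : 0 < K) {x y : ℝ} (hxy : x < y)
    (h : quantileIndex ν K x = quantileIndex ν K y) : ν.real (Set.Icc x y) ≤ 1 / K := by
  simp only [quantileIndex, Prod.mk.injEq, Fin.mk.injEq] at h
  have hK' : (0 : ℝ) < K := Nat.cast_pos.2 hK
  have hfloor : ⌊K * ν.real (Set.Iic x)⌋₊ ≤ ⌊K * ν.real (Set.Iio y)⌋₊ :=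
    monotone_floor_mul_real ν K (Set.Iic_subset_Iio.2 hxy)
  have hlow : (⌊K * ν.real (Set.Iio x)⌋₊ : ℝ) ≤ K * ν.real (Set.Iio x) :=
    Nat.floor_le (by positivity)
  have hup : K * ν.real (Set.Iic y) < ⌊K * ν.real (Set.Iio x)⌋₊ + 1 := by
    refine (Nat.lt_floor_add_one _).trans_le (add_le_add_left (Nat.cast_le.2 ?_) 1)
    rwa [← h.1, h.2]
  have hadd : ν.real (Set.Iic y) = ν.real (Set.Iio x) + ν.real (Set.Icc x y) := by
    rw [← measureReal_union _ measurableSet_Icc, Set.Iio_union_Icc_eq_Iic hxy.le]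
    exact Set.disjoint_left.2 fun z hz hz' => hz'.1.not_gt hz
  rw [le_div_iff₀ hK']
  nlinarith

theorem real_quantileIndex_preimage_le (hK : 0 < K) {k : Fin (K + 1) × Fin (K + 1)}
    (hne : (quantileIndex ν K ⁻¹' {k}).Nontrivial) :
    ν.real (quantileIndex ν K ⁻¹' {k}) ≤ 1 / K := by
  refine ENNReal.toReal_le_of_le_ofReal (by positivity) (measure_le_of_forall_Icc_le
    (measurable_quantileIndex ν K (.singleton k)) hne fun a ha b hb hab => ?_)
  rw [← ofReal_measureReal]
  exact ENNReal.ofReal_le_ofReal (real_Icc_le_of_quantileIndex_eq hK hab (ha.trans hb.symm))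

theorem sum_mul_core_quantileIndex_le (hK : 0 < K) {M : Set ℝ → ℝ} (hM : IsProbabilityContent M) :
    ∑ k, ν.real (quantileIndex ν K ⁻¹' {k}) * M (core (quantileIndex ν K ⁻¹' {k})) ≤ 1 / K := by
  have hmeas := fun k => measurableSet_core (ordConnected_quantileIndex_preimage ν K k)
  calc ∑ k, ν.real (quantileIndex ν K ⁻¹' {k}) * M (core (quantileIndex ν K ⁻¹' {k}))
      ≤ ∑ k, 1 / K * M (core (quantileIndex ν K ⁻¹' {k})) := by
        refine Finset.sum_le_sum fun k _ => ?_
        rcases Set.subsingleton_or_nontrivial (quantileIndex ν K ⁻¹' {k}) with hs | hs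
        · simp [core_eq_empty hs, hM.empty]
        · exact mul_le_mul_of_nonneg_right (real_quantileIndex_preimage_le hK hs) (hM.nonneg _)
    _ = 1 / K * M (⋃ k, core (quantileIndex ν K ⁻¹' {k})) := by
        rw [← Finset.mul_sum, hM.iUnion_fintype (fun k l hkl => ?_) hmeas]
        exact ((Set.disjoint_singleton.2 hkl).preimage _).mono Set.sdiff_subset Set.sdiff_subset
    _ ≤ 1 / K := mul_le_of_le_one_right (by positivity) (hM.le_one (.iUnion hmeas))

end Quantile

theorem integral_comp_eq_sum {α κ : Type*} [MeasurableSpace α] [MeasurableSpace κ] [Fintype κ]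
    [MeasurableSingletonClass κ] (μ : Measure α) [IsFiniteMeasure μ] {Z : α → κ} (hZ : Measurable Z)
    (f : κ → ℝ) : ∫ x, f (Z x) ∂μ = ∑ k, μ.real (Z ⁻¹' {k}) * f k := by
  rw [← integral_map (f := f) hZ.aemeasurable (measurable_of_finite f).aestronglyMeasurable,
    integral_fintype .of_finite]
  exact Finset.sum_congr rfl fun k _ => by
    rw [map_measureReal_apply hZ (.singleton k), smul_eq_mul]

section Grid

variable (PT : Measure (Fin q → ℝ)) [IsProbabilityMeasure PT] (K : ℕ)

/-- The law of the `j`-th entry of a parameter with law `PT`. -/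
abbrev marginal (j : Fin q) : Measure ℝ := PT.map (Function.eval j)

instance (j : Fin q) : IsProbabilityMeasure (marginal PT j) :=
  Measure.isProbabilityMeasure_map (measurable_pi_apply j).aemeasurable

/-- The index of a parameter in the grid whose blocks are products of quantile blocks of the
marginal laws. -/
def gridIndex (t : Fin q → ℝ) (j : Fin q) : Fin (K + 1) × Fin (K + 1) :=
  quantileIndex (marginal PT j) K (t j)

/-- A parameter in the grid block with index `κ`, arbitrary if that block is empty. -/
def gridPoint (κ : Fin q → Fin (K + 1) × Fin (K + 1)) : Fin q → ℝ :=
  Function.invFun (gridIndex PT K) κ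

/-- The sum over the coordinates of the `M`-masses of the sides of the block with index `κ`; it
bounds the oscillation of `t ↦ M (R_t^(i))` on that block. -/
def gridWidth (M : Set ℝ → ℝ) (κ : Fin q → Fin (K + 1) × Fin (K + 1)) : ℝ :=
  ∑ j, M (core (quantileIndex (marginal PT j) K ⁻¹' {κ j}))

theorem measurable_gridIndex : Measurable (gridIndex PT K) :=
  measurable_pi_lambda _ fun j => (measurable_quantileIndex _ K).comp (measurable_pi_apply j)

variable {M : Set ℝ → ℝ}

theorem gridWidth_nonneg (hM : IsProbabilityContent M) (κ : Fin q → Fin (K + 1) × Fin (K + 1)) :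
    0 ≤ gridWidth PT K M κ :=
  Finset.sum_nonneg fun _ _ => hM.nonneg _

theorem RangeMap.IsOrderDetermined.abs_sub_gridPoint_le (hR : R.IsOrderDetermined)
    (hM : IsProbabilityContent M) (t : Fin q → ℝ) (i : Fin m) :
    |M (R.range t i) - M (R.range (gridPoint PT K (gridIndex PT K t)) i)| ≤
      gridWidth PT K M (gridIndex PT K t) := by
  refine (hR.abs_sub_le hM t _ i).trans (Finset.sum_le_sum fun j _ => ?_)
  have hconn := ordConnected_quantileIndex_preimage (marginal PT j) K (gridIndex PT K t j)
  have hpoint : gridIndex PT K (gridPoint PT K (gridIndex PT K t)) = gridIndex PT K t :=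
    Function.invFun_eq ⟨t, rfl⟩
  exact hM.mono measurableSet_uIoc (measurableSet_core hconn)
    (uIoc_subset_core hconn rfl (congrFun hpoint j))

theorem integral_gridWidth_le (hK : 0 < K) (hM : IsProbabilityContent M) :
    ∫ t, gridWidth PT K M (gridIndex PT K t) ∂PT ≤ q / K := by
  let width j k := M (core (quantileIndex (marginal PT j) K ⁻¹' {k}))
  have hmeas j : Measurable fun t : Fin q → ℝ => quantileIndex (marginal PT j) K (t j) :=
    (measurable_quantileIndex _ K).comp (measurable_pi_apply j)
  calc ∫ t, gridWidth PT K M (gridIndex PT K t) ∂PT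
      = ∑ j, ∫ t, width j (quantileIndex (marginal PT j) K (t j)) ∂PT :=
        integral_finsetSum _ fun j _ =>
          (Integrable.of_finite (f := width j)).comp_measurable (hmeas j)
    _ ≤ ∑ _j : Fin q, 1 / (K : ℝ) := by
        refine Finset.sum_le_sum fun j _ => ?_
        rw [integral_comp_eq_sum PT (hmeas j)]
        refine le_of_eq_of_le ?_ (sum_mul_core_quantileIndex_le (ν := marginal PT j) hK hM)
        refine Finset.sum_congr rfl fun k _ => ?_
        rw [map_measureReal_apply (measurable_pi_apply j)
          (measurable_quantileIndex _ K (.singleton k))]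
        rfl
    _ = q / K := by simp [div_eq_mul_inv]

end Grid

theorem ae_tendsto_average {α Ω : Type*} [MeasurableSpace α] [MeasurableSpace Ω] {P : Measure Ω}
    {μ : Measure α} {X : ℕ → Ω → α} (hX : ∀ j, HasLaw (X j) μ P)
    (hindep : Pairwise fun i j => IndepFun (X i) (X j) P) {φ : α → ℝ} (hφ : Measurable φ)
    (hint : Integrable φ μ) :
    ∀ᵐ ω ∂P, Tendsto (fun n : ℕ => (∑ j ∈ Finset.range n, φ (X j ω)) / n) atTop
      (𝓝 (∫ x, φ x ∂μ)) := by
  have hslln := strong_law_ae_real (μ := P) (fun j => φ ∘ X j)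
    ((integrable_map_measure hφ.aestronglyMeasurable (hX 0).aemeasurable).1
      ((hX 0).map_eq.symm ▸ hint))
    (fun i j hij => (hindep hij).comp hφ hφ)
    (fun j => ((hX j).identDistrib (hX 0)).comp hφ)
  rwa [(hX 0).integral_comp hφ.aestronglyMeasurable] at hslln

theorem mul_eq_sum_indicator {α κ : Type*} [Fintype κ] (Z : α → κ) (φ : α → ℝ) (a : κ → ℝ) (x : α) :
    a (Z x) * φ x = ∑ k, a k * (Z ⁻¹' {k}).indicator φ x := by
  classical
  simp [Set.indicator_apply, eq_comm (a := Z x)]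

theorem tendsto_average_mul {α κ : Type*} [Finite κ] [MeasurableSpace κ]
    [MeasurableSingletonClass κ] [MeasurableSpace α] {μ : Measure α} {x : ℕ → α} {φ : α → ℝ}
    {Z : α → κ} (hφ : Integrable φ μ) (hZ : Measurable Z)
    (hx : ∀ k, Tendsto
      (fun n : ℕ => (∑ j ∈ Finset.range n, (Z ⁻¹' {k}).indicator φ (x j)) / n) atTop
      (𝓝 (∫ x, (Z ⁻¹' {k}).indicator φ x ∂μ)))
    {𝒰 : Filter ℕ} (h𝒰 : 𝒰 ≤ atTop) {a : ℕ → κ → ℝ} {b : κ → ℝ} (ha : Tendsto a 𝒰 (𝓝 b)) :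
    Tendsto (fun n : ℕ => (∑ j ∈ Finset.range n, a n (Z (x j)) * φ (x j)) / n) 𝒰
      (𝓝 (∫ x, b (Z x) * φ x ∂μ)) := by
  have := Fintype.ofFinite κ
  simp only [mul_eq_sum_indicator]
  rw [integral_finsetSum _ fun k _ => (hφ.indicator (hZ (.singleton k))).const_mul _]
  simp only [integral_const_mul]
  refine (tendsto_finsetSum Finset.univ fun k _ =>
    (ha.apply_nhds k).mul ((hx k).mono_left h𝒰)).congr fun n => ?_
  rw [Finset.sum_comm, Finset.sum_div]
  simp only [← Finset.mul_sum, mul_div_assoc]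

theorem abs_inv_add_sub_inv_add_le {a b δ : ℝ} (ha : 0 ≤ a) (hb : 0 ≤ b) (hδ : 0 < δ) :
    |(a + δ)⁻¹ - (b + δ)⁻¹| ≤ |a - b| / δ ^ 2 := by
  have ha' : 0 < a + δ := by positivity
  have hb' : 0 < b + δ := by positivity
  rw [inv_sub_inv ha'.ne' hb'.ne', add_sub_add_right_eq_sub, abs_div, abs_sub_comm b a,
    abs_of_pos (mul_pos ha' hb')]
  gcongr
  nlinarith

namespace RangeMap.IsOrderDetermined

variable {PT : Measure (Fin q → ℝ)} {PY : Measure ℝ} {M : Set ℝ → ℝ}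
  {μ : Measure ((Fin q → ℝ) × ℝ)}

theorem measurable_label (hR : R.IsOrderDetermined) :
    Measurable fun x : (Fin q → ℝ) × ℝ => R.label x.1 x.2 :=
  measurable_to_countable' fun i => by
    simpa only [Set.preimage, Set.mem_singleton_iff, R.label_eq_iff] using
      hR.measurableSet_mem_range i

theorem measurable_cell (hR : R.IsOrderDetermined) (hM : IsProbabilityContent M) :
    Measurable fun x : (Fin q → ℝ) × ℝ => M (R.cell x.1 x.2) :=
  (measurable_from_prod_countable_right (f := fun x : Fin m × (Fin q → ℝ) => M (R.range x.2 x.1))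
    fun i => hR.measurable hM i).comp (hR.measurable_label.prodMk measurable_fst)

theorem integrable_mul_cell [IsProbabilityMeasure PY] (hR : R.IsOrderDetermined)
    {f : (Fin q → ℝ) × ℝ → ℝ} (hf : Integrable f μ) :
    Integrable (fun x => f x * PY.real (R.cell x.1 x.2)) μ := by
  refine hf.mul_bdd (c := 1)
    (hR.measurable_cell (isProbabilityContent_real PY)).aestronglyMeasurable
    (ae_of_all _ fun x => ?_)
  rw [Real.norm_of_nonneg measureReal_nonneg]
  exact measureReal_le_one

theorem integrable_inv_cell [IsFiniteMeasure μ] (hR : R.IsOrderDetermined)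
    (hM : IsProbabilityContent M) {δ : ℝ} (hδ : 0 < δ) :
    Integrable (fun x => (M (R.cell x.1 x.2) + δ)⁻¹) μ := by
  refine .of_bound ((hR.measurable_cell hM).add_const δ).inv.aestronglyMeasurable δ⁻¹
    (ae_of_all _ fun x => ?_)
  have hcell := hM.nonneg (R.cell x.1 x.2)
  rw [Real.norm_of_nonneg (by positivity)]
  exact inv_anti₀ hδ (le_add_of_nonneg_left hcell)

theorem integral_comp_label [IsFiniteMeasure PY] (hR : R.IsOrderDetermined)
    (t : Fin q → ℝ) (f : Fin m → ℝ) :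
    ∫ y, f (R.label t y) ∂PY = ∑ i, PY.real (R.range t i) * f i := by
  rw [integral_comp_eq_sum PY (Z := R.label t) (hR.measurable_label.comp measurable_prodMk_left)]
  refine Finset.sum_congr rfl fun i _ => ?_
  congr 2
  ext y
  exact R.label_eq_iff

variable [IsFiniteMeasure PY] {f : (Fin q → ℝ) → Fin m → ℝ}

theorem integrable_sum_mul (hR : R.IsOrderDetermined)
    (hf : Integrable (fun x => f x.1 (R.label x.1 x.2)) (PT.prod PY)) :
    Integrable (fun t => ∑ i, PY.real (R.range t i) * f t i) PT := by
  simpa only [hR.integral_comp_label] using hf.integral_prod_left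

theorem integral_sum_mul [SFinite PT] (hR : R.IsOrderDetermined)
    (hf : Integrable (fun x => f x.1 (R.label x.1 x.2)) (PT.prod PY)) :
    ∫ t, ∑ i, PY.real (R.range t i) * f t i ∂PT =
      ∫ x, f x.1 (R.label x.1 x.2) ∂PT.prod PY := by
  simp only [integral_prod _ hf, hR.integral_comp_label]

end RangeMap.IsOrderDetermined

namespace RangeMap

variable (R)

/-- The parameter up to its grid block, together with the index of the observed range. -/
def gridLabel (PT : Measure (Fin q → ℝ)) [IsProbabilityMeasure PT] (K : ℕ)
    (x : (Fin q → ℝ) × ℝ) : (Fin q → Fin (K + 1) × Fin (K + 1)) × Fin m :=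
  (gridIndex PT K x.1, R.label x.1 x.2)

/-- A minorant of `(M (R_t^(i)) + δ)⁻¹` that depends on `t` only through its grid block. -/
def lowerScore (PT : Measure (Fin q → ℝ)) [IsProbabilityMeasure PT] (K : ℕ) (δ : ℝ) (M : Set ℝ → ℝ)
    (k : (Fin q → Fin (K + 1) × Fin (K + 1)) × Fin m) : ℝ :=
  (M (R.range (gridPoint PT K k.1) k.2) + δ)⁻¹ - gridWidth PT K M k.1 / δ ^ 2

/-- A sequence of pairs `(t, y)` along which the law of large numbers for `PT.prod PY` holds for the
probability under `PY` of the observed range, restricted to any value of `RangeMap.gridLabel`. -/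
def IsTypicalSample (PT : Measure (Fin q → ℝ)) [IsProbabilityMeasure PT] (PY : Measure ℝ)
    (x : ℕ → (Fin q → ℝ) × ℝ) : Prop :=
  ∀ (K : ℕ) (k : (Fin q → Fin (K + 1) × Fin (K + 1)) × Fin m),
    Tendsto (fun n : ℕ => (∑ j ∈ Finset.range n, (R.gridLabel PT K ⁻¹' {k}).indicator
        (fun x => PY.real (R.cell x.1 x.2)) (x j)) / n) atTop
      (𝓝 (∫ x, (R.gridLabel PT K ⁻¹' {k}).indicator (fun x => PY.real (R.cell x.1 x.2)) x
        ∂PT.prod PY))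

variable {R} {PT : Measure (Fin q → ℝ)} [IsProbabilityMeasure PT] {PY : Measure ℝ}
  {M : Set ℝ → ℝ} {K : ℕ} {δ : ℝ}

theorem tendsto_lowerScore {ι : Type*} {𝒰 : Filter ι} {F : ι → Set ℝ → ℝ} (hF : Tendsto F 𝒰 (𝓝 M))
    (hM : IsProbabilityContent M) (hδ : 0 < δ) :
    Tendsto (fun n => R.lowerScore PT K δ (F n)) 𝒰 (𝓝 (R.lowerScore PT K δ M)) :=
  tendsto_pi_nhds.2 fun _ =>
    (((hF.apply_nhds _).add_const δ).inv₀ (add_pos_of_nonneg_of_pos (hM.nonneg _) hδ).ne').sub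
      ((tendsto_finsetSum _ fun _ _ => hF.apply_nhds _).div_const _)

namespace IsOrderDetermined

theorem measurable_gridLabel (hR : R.IsOrderDetermined) : Measurable (R.gridLabel PT K) :=
  ((measurable_gridIndex PT K).comp measurable_fst).prodMk hR.measurable_label

theorem ae_isTypicalSample [IsProbabilityMeasure PY] {Ω : Type*} [MeasurableSpace Ω] {P : Measure Ω}
    {X : ℕ → Ω → (Fin q → ℝ) × ℝ} (hR : R.IsOrderDetermined)
    (hX : ∀ j, HasLaw (X j) (PT.prod PY) P)
    (hindep : Pairwise fun i j => IndepFun (X i) (X j) P) :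
    ∀ᵐ ω ∂P, R.IsTypicalSample PT PY fun j => X j ω := by
  have hcell := hR.measurable_cell (isProbabilityContent_real PY)
  refine ae_all_iff.2 fun K => ae_all_iff.2 fun k => ?_
  have hmeas := hcell.indicator (hR.measurable_gridLabel (PT := PT) (.singleton k))
  refine ae_tendsto_average hX hindep hmeas
    (.of_bound hmeas.aestronglyMeasurable 1 (ae_of_all _ fun x => ?_))
  refine (norm_indicator_le_norm_self _ x).trans ?_
  rw [Real.norm_of_nonneg measureReal_nonneg]
  exact measureReal_le_one

theorem abs_inv_cell_sub_le (hR : R.IsOrderDetermined) (hM : IsProbabilityContent M) (hδ : 0 < δ)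
    (K : ℕ) (x : (Fin q → ℝ) × ℝ) :
    |(M (R.cell x.1 x.2) + δ)⁻¹ -
        (M (R.range (gridPoint PT K (gridIndex PT K x.1)) (R.label x.1 x.2)) + δ)⁻¹| ≤
      gridWidth PT K M (gridIndex PT K x.1) / δ ^ 2 :=
  (abs_inv_add_sub_inv_add_le (hM.nonneg _) (hM.nonneg _) hδ).trans
    (div_le_div_of_nonneg_right (hR.abs_sub_gridPoint_le PT K hM x.1 _) (sq_nonneg δ))

theorem lowerScore_le (hR : R.IsOrderDetermined) (hM : IsProbabilityContent M) (hδ : 0 < δ) (K : ℕ)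
    (x : (Fin q → ℝ) × ℝ) :
    R.lowerScore PT K δ M (R.gridLabel PT K x) ≤ (M (R.cell x.1 x.2) + δ)⁻¹ :=
  sub_le_comm.1 (abs_sub_le_iff.1 (hR.abs_inv_cell_sub_le hM hδ K x)).2

theorem le_lowerScore_add (hR : R.IsOrderDetermined) (hM : IsProbabilityContent M) (hδ : 0 < δ)
    (K : ℕ) (x : (Fin q → ℝ) × ℝ) :
    (M (R.cell x.1 x.2) + δ)⁻¹ ≤ R.lowerScore PT K δ M (R.gridLabel PT K x) +
      2 * (gridWidth PT K M (gridIndex PT K x.1) / δ ^ 2) := by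
  have := (abs_sub_le_iff.1 (hR.abs_inv_cell_sub_le (PT := PT) hM hδ K x)).1
  simp only [lowerScore, gridLabel]
  linarith

variable [IsProbabilityMeasure PY]

theorem integral_inv_cell_mul_le (hR : R.IsOrderDetermined) (hM : IsProbabilityContent M)
    (hδ : 0 < δ) (hK : 0 < K) :
    ∫ x, (M (R.cell x.1 x.2) + δ)⁻¹ * PY.real (R.cell x.1 x.2) ∂PT.prod PY ≤
      ∫ x, R.lowerScore PT K δ M (R.gridLabel PT K x) * PY.real (R.cell x.1 x.2) ∂PT.prod PY +
        2 * (q / K / δ ^ 2) := by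
  have hscore : Integrable (fun x => R.lowerScore PT K δ M (R.gridLabel PT K x) *
      PY.real (R.cell x.1 x.2)) (PT.prod PY) :=
    hR.integrable_mul_cell
      ((Integrable.of_finite (f := R.lowerScore PT K δ M)).comp_measurable hR.measurable_gridLabel)
  have hwidth : Integrable (fun t => 2 * (gridWidth PT K M (gridIndex PT K t) / δ ^ 2)) PT :=
    (((Integrable.of_finite (f := gridWidth PT K M)).comp_measurable
      (measurable_gridIndex PT K)).div_const _).const_mul 2
  calc ∫ x, (M (R.cell x.1 x.2) + δ)⁻¹ * PY.real (R.cell x.1 x.2) ∂PT.prod PY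
      ≤ ∫ x, (R.lowerScore PT K δ M (R.gridLabel PT K x) * PY.real (R.cell x.1 x.2) +
          2 * (gridWidth PT K M (gridIndex PT K x.1) / δ ^ 2)) ∂PT.prod PY := by
        refine integral_mono (hR.integrable_mul_cell (hR.integrable_inv_cell hM hδ))
          (hscore.add (hwidth.comp_fst PY)) fun x => ?_
        have hwidth_nonneg := gridWidth_nonneg PT K hM (gridIndex PT K x.1)
        calc (M (R.cell x.1 x.2) + δ)⁻¹ * PY.real (R.cell x.1 x.2)
            ≤ (R.lowerScore PT K δ M (R.gridLabel PT K x) +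
                2 * (gridWidth PT K M (gridIndex PT K x.1) / δ ^ 2)) * PY.real (R.cell x.1 x.2) :=
              mul_le_mul_of_nonneg_right (hR.le_lowerScore_add hM hδ K x) measureReal_nonneg
          _ ≤ _ := by
              rw [add_mul]
              exact add_le_add_right
                (mul_le_of_le_one_right (by positivity) measureReal_le_one) _
    _ = ∫ x, R.lowerScore PT K δ M (R.gridLabel PT K x) * PY.real (R.cell x.1 x.2) ∂PT.prod PY +
          2 * ((∫ t, gridWidth PT K M (gridIndex PT K t) ∂PT) / δ ^ 2) := by
        rw [integral_add hscore (hwidth.comp_fst PY), integral_fun_fst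
          (fun t => 2 * (gridWidth PT K M (gridIndex PT K t) / δ ^ 2)), integral_const_mul,
          integral_div]
        simp
    _ ≤ _ := by
        gcongr
        exact integral_gridWidth_le PT K hK hM

end IsOrderDetermined

namespace IsTypicalSample

variable [IsProbabilityMeasure PY] {x : ℕ → (Fin q → ℝ) × ℝ} {F : ℕ → Set ℝ → ℝ} {𝒰 : Filter ℕ}
  [𝒰.NeBot]

theorem integral_lowerScore_mul_le (hx : R.IsTypicalSample PT PY x) (hR : R.IsOrderDetermined)
    (h𝒰 : 𝒰 ≤ atTop) (hF : ∀ n, IsProbabilityContent (F n)) (hFM : Tendsto F 𝒰 (𝓝 M)) (hδ : 0 < δ)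
    (hle : ∀ᶠ n : ℕ in 𝒰, ∑ j ∈ Finset.range n, (F n (R.cell (x j).1 (x j).2) + δ)⁻¹ *
      PY.real (R.cell (x j).1 (x j).2) ≤ n) (K : ℕ) :
    ∫ x, R.lowerScore PT K δ M (R.gridLabel PT K x) * PY.real (R.cell x.1 x.2) ∂PT.prod PY ≤ 1 := by
  have hint : Integrable (fun x => PY.real (R.cell x.1 x.2)) (PT.prod PY) := by
    simpa using hR.integrable_mul_cell (μ := PT.prod PY) (PY := PY) (integrable_const 1)
  refine le_of_tendsto (tendsto_average_mul hint hR.measurable_gridLabel (hx K) h𝒰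
    (tendsto_lowerScore hFM (.of_tendsto hF hFM) hδ)) (hle.mono fun n hn => ?_)
  refine div_le_one_of_le₀ (le_trans ?_ hn) n.cast_nonneg
  exact Finset.sum_le_sum fun j _ =>
    mul_le_mul_of_nonneg_right (hR.lowerScore_le (hF n) hδ K (x j)) measureReal_nonneg

theorem integral_inv_cell_mul_le_one (hx : R.IsTypicalSample PT PY x) (hR : R.IsOrderDetermined)
    (h𝒰 : 𝒰 ≤ atTop) (hF : ∀ n, IsProbabilityContent (F n)) (hFM : Tendsto F 𝒰 (𝓝 M)) (hδ : 0 < δ)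
    (hle : ∀ᶠ n : ℕ in 𝒰, ∑ j ∈ Finset.range n, (F n (R.cell (x j).1 (x j).2) + δ)⁻¹ *
      PY.real (R.cell (x j).1 (x j).2) ≤ n) :
    ∫ x, (M (R.cell x.1 x.2) + δ)⁻¹ * PY.real (R.cell x.1 x.2) ∂PT.prod PY ≤ 1 := by
  have hlim : Tendsto (fun K : ℕ => 1 + 2 * ((q : ℝ) / K / δ ^ 2)) atTop (𝓝 1) := by
    simpa using (((tendsto_const_div_atTop_nhds_zero_nat (q : ℝ)).div_const _).const_mul 2
      ).const_add 1
  refine ge_of_tendsto hlim ((eventually_gt_atTop 0).mono fun K hK => ?_)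
  exact (hR.integral_inv_cell_mul_le (.of_tendsto hF hFM) hδ hK).trans
    (add_le_add_left (hx.integral_lowerScore_mul_le hR h𝒰 hF hFM hδ hle K) _)

end IsTypicalSample

end RangeMap

theorem sum_sq_sub_le {ι : Type*} [Fintype ι] {p x : ι → ℝ} {δ : ℝ} (hp : ∑ i, p i = 1)
    (hx : ∑ i, x i = 1) (hx0 : ∀ i, 0 ≤ x i) (hδ : 0 < δ) (hδ1 : δ ≤ 1) :
    ∑ i, (p i - x i) ^ 2 ≤
      2 * (∑ i, p i * ((x i + δ)⁻¹ * p i) - 1 + Fintype.card ι * δ) := by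
  have hx1 : ∀ i, x i ≤ 1 := fun i =>
    (Finset.single_le_sum (fun j _ => hx0 j) (Finset.mem_univ i)).trans_eq hx
  have hterm : ∀ i, (p i - x i) ^ 2 - 2 * δ * (p i - x i) ≤
      2 * (p i * ((x i + δ)⁻¹ * p i) - 2 * p i + (x i + δ)) := fun i => by
    have hpos : 0 < x i + δ := add_pos_of_nonneg_of_pos (hx0 i) hδ
    calc (p i - x i) ^ 2 - 2 * δ * (p i - x i) ≤ (p i - (x i + δ)) ^ 2 := by
          nlinarith [sq_nonneg δ]
      _ = (x i + δ) * ((p i - (x i + δ)) ^ 2 / (x i + δ)) := by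
          rw [mul_div_cancel₀ _ hpos.ne']
      _ ≤ 2 * ((p i - (x i + δ)) ^ 2 / (x i + δ)) := by
          gcongr
          linarith [hx1 i]
      _ = _ := by
          field_simp
          ring
  have hsum := Finset.sum_le_sum fun i (_ : i ∈ Finset.univ) => hterm i
  simp only [Finset.sum_sub_distrib, Finset.sum_add_distrib, ← Finset.mul_sum, hp, hx,
    Finset.sum_const, Finset.card_univ, nsmul_eq_mul] at hsum
  linarith

namespace RangeMap.IsOrderDetermined

variable {PT : Measure (Fin q → ℝ)} [IsProbabilityMeasure PT] {PY : Measure ℝ}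
  [IsProbabilityMeasure PY] {M : Set ℝ → ℝ}

theorem integral_sum_sq_sub_le (hR : R.IsOrderDetermined) (hM : IsProbabilityContent M) {δ : ℝ}
    (hδ : 0 < δ) (hδ1 : δ ≤ 1)
    (hle : ∫ x, (M (R.cell x.1 x.2) + δ)⁻¹ * PY.real (R.cell x.1 x.2) ∂PT.prod PY ≤ 1) :
    ∫ t, ∑ i, (PY.real (R.range t i) - M (R.range t i)) ^ 2 ∂PT ≤ 2 * (m * δ) := by
  let score (t : Fin q → ℝ) (i : Fin m) := (M (R.range t i) + δ)⁻¹ * PY.real (R.range t i)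
  have hscore : Integrable (fun x => score x.1 (R.label x.1 x.2)) (PT.prod PY) :=
    hR.integrable_mul_cell (hR.integrable_inv_cell hM hδ)
  have hsum := hR.integrable_sum_mul hscore
  have hsub : Integrable (fun t => ∑ i, PY.real (R.range t i) * score t i - 1) PT :=
    hsum.sub (integrable_const 1)
  calc ∫ t, ∑ i, (PY.real (R.range t i) - M (R.range t i)) ^ 2 ∂PT
      ≤ ∫ t, 2 * (∑ i, PY.real (R.range t i) * score t i - 1 + m * δ) ∂PT := by
        refine integral_mono_of_nonneg
          (ae_of_all _ fun t => Finset.sum_nonneg fun i _ => sq_nonneg _)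
          ((hsub.add (integrable_const _)).const_mul 2) (ae_of_all _ fun t => ?_)
        simpa using sum_sq_sub_le (R.sum_eq_one (isProbabilityContent_real PY) t)
          (R.sum_eq_one hM t) (fun i => hM.nonneg _) hδ hδ1
    _ = 2 * (∫ x, score x.1 (R.label x.1 x.2) ∂PT.prod PY - 1 + m * δ) := by
        rw [integral_const_mul, integral_add hsub (integrable_const _),
          integral_sub hsum (integrable_const 1), hR.integral_sum_mul hscore]
        simp
    _ ≤ 2 * (m * δ) := by
        have : ∫ x, score x.1 (R.label x.1 x.2) ∂PT.prod PY ≤ 1 := hle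
        linarith

theorem integrable_sq_sub (hR : R.IsOrderDetermined) (hM : IsProbabilityContent M) (i : Fin m) :
    Integrable (fun t => (PY.real (R.range t i) - M (R.range t i)) ^ 2) PT := by
  have hPY := isProbabilityContent_real PY
  refine .of_bound
    (((hR.measurable hPY i).sub (hR.measurable hM i)).pow_const 2).aestronglyMeasurable 1
    (ae_of_all _ fun t => ?_)
  have hrange := R.measurableSet_range t i
  rw [norm_pow]
  exact pow_le_one₀ (norm_nonneg _) (abs_sub_le_of_nonneg_of_le (hPY.nonneg _) (hPY.le_one hrange)
    (hM.nonneg _) (hM.le_one hrange))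

theorem ae_eq_of_integral_inv_cell_mul_le_one (hR : R.IsOrderDetermined)
    (hM : IsProbabilityContent M)
    (hle : ∀ δ > 0, ∫ x, (M (R.cell x.1 x.2) + δ)⁻¹ * PY.real (R.cell x.1 x.2) ∂PT.prod PY ≤ 1)
    (i : Fin m) : (fun t => M (R.range t i)) =ᵐ[PT] fun t => PY.real (R.range t i) := by
  let dist (t : Fin q → ℝ) := ∑ i, (PY.real (R.range t i) - M (R.range t i)) ^ 2
  have hnonneg : 0 ≤ dist := fun t => Finset.sum_nonneg fun i _ => sq_nonneg _
  have hint : Integrable dist PT := integrable_finsetSum _ fun i _ => hR.integrable_sq_sub hM i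
  have hlim : Tendsto (fun δ : ℝ => 2 * (m * δ)) (𝓝[>] 0) (𝓝 0) :=
    (Continuous.tendsto' (by fun_prop) 0 0 (by simp)).mono_left nhdsWithin_le_nhds
  have hzero : ∫ t, dist t ∂PT = 0 := by
    refine le_antisymm (ge_of_tendsto hlim ?_) (integral_nonneg hnonneg)
    filter_upwards [Ioo_mem_nhdsGT zero_lt_one] with δ hδ
    exact hR.integral_sum_sq_sub_le hM hδ.1 hδ.2.le (hle δ hδ.1)
  filter_upwards [(integral_eq_zero_iff_of_nonneg hnonneg hint).1 hzero] with t ht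
  have hsq := (Finset.sum_eq_zero_iff_of_nonneg fun i _ => sq_nonneg _).1 ht i (Finset.mem_univ i)
  exact (sub_eq_zero.1 (sq_eq_zero_iff.1 hsq)).symm

end RangeMap.IsOrderDetermined

theorem abs_sub_lt_of_monotone_of_mem_Icc {f g : ℝ → ℝ} (hf : Monotone f) (hg : Monotone g)
    {a b x ε : ℝ} (ha : g b - ε < f a) (hb : f b < g a + ε) (hx : x ∈ Set.Icc a b) :
    |g x - f x| < ε := by
  rw [abs_sub_lt_iff]
  constructor <;> linarith [hf hx.1, hf hx.2, hg hx.1, hg hx.2]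

section UniformConvergence

variable {ι : Type*} {𝒰 : Filter ι} {ν : ι → Measure ℝ} {μ : Measure ℝ}

theorem eventually_forall_mem_Icc_abs_cdf_sub_lt
    (h : ∀ x, Tendsto (fun n => cdf (ν n) x) 𝒰 (𝓝 (cdf μ x))) {a b ε : ℝ}
    (hab : cdf μ b - ε < cdf μ a) :
    ∀ᶠ n in 𝒰, ∀ x ∈ Set.Icc a b, |cdf μ x - cdf (ν n) x| < ε := by
  filter_upwards [(h a).eventually_const_lt hab,
    (h b).eventually_lt_const (sub_lt_iff_lt_add.1 hab)] with n ha hb x hx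
  exact abs_sub_lt_of_monotone_of_mem_Icc (monotone_cdf _) (monotone_cdf _) ha hb hx

theorem tendstoUniformly_cdf (hcont : Continuous (cdf μ))
    (h : ∀ x, Tendsto (fun n => cdf (ν n) x) 𝒰 (𝓝 (cdf μ x))) :
    TendstoUniformly (fun n x => cdf (ν n) x) (cdf μ) 𝒰 := by
  simp only [Metric.tendstoUniformly_iff, Real.dist_eq]
  intro ε hε
  obtain ⟨a, ha⟩ := ((tendsto_cdf_atBot μ).eventually_lt_const hε).exists
  obtain ⟨b, hb⟩ := ((tendsto_cdf_atTop μ).eventually_const_lt (sub_lt_self 1 hε)).exists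
  have hmiddle : ∀ᶠ n in 𝒰, ∀ x ∈ Set.Icc a b, |cdf μ x - cdf (ν n) x| < ε := by
    refine isCompact_Icc.induction_on
      (p := fun s => ∀ᶠ n in 𝒰, ∀ x ∈ s, |cdf μ x - cdf (ν n) x| < ε)
      (by simp) (fun s t hst ht => ht.mono fun n hn x hx => hn x (hst hx))
      (fun s t hs ht => (hs.and ht).mono fun n hn x hx => hx.elim (hn.1 x) (hn.2 x)) fun x _ => ?_
    have hosc : Tendsto (fun r => cdf μ (x + r) - cdf μ (x - r)) (𝓝[>] 0) (𝓝 0) :=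
      (Continuous.tendsto' (by fun_prop) 0 0 (by simp)).mono_left nhdsWithin_le_nhds
    obtain ⟨r, hr, hr0⟩ := ((hosc.eventually_lt_const hε).and self_mem_nhdsWithin).exists
    have hnhds := Icc_mem_nhds (sub_lt_self x hr0) (lt_add_of_pos_right x hr0)
    exact ⟨_, mem_nhdsWithin_of_mem_nhds hnhds,
      eventually_forall_mem_Icc_abs_cdf_sub_lt h (sub_lt_comm.1 hr)⟩
  filter_upwards [hmiddle, (h a).eventually_lt_const ha, (h b).eventually_const_lt hb]
    with n hmiddle ha' hb' x
  rcases le_or_gt x a with hxa | hxa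
  · refine abs_sub_lt_of_nonneg_of_lt (cdf_nonneg μ x) ?_ (cdf_nonneg (ν n) x) ?_
    exacts [(monotone_cdf μ hxa).trans_lt ha, (monotone_cdf (ν n) hxa).trans_lt ha']
  rcases le_or_gt b x with hbx | hbx
  · have := monotone_cdf μ hbx
    have := monotone_cdf (ν n) hbx
    rw [abs_sub_lt_iff]
    constructor <;> linarith [cdf_le_one μ x, cdf_le_one (ν n) x]
  · exact hmiddle x ⟨hxa.le, hbx.le⟩

end UniformConvergence

theorem tendsto_iSup_abs_sub {ι α : Type*} {𝒰 : Filter ι} {f : ι → α → ℝ} {g : α → ℝ}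
    (h : TendstoUniformly f g 𝒰) (s : Set α) :
    Tendsto (fun n => ⨆ x : s, |f n x - g x|) 𝒰 (𝓝 0) := by
  rw [Metric.tendsto_nhds]
  intro ε hε
  filter_upwards [Metric.tendstoUniformly_iff.1 h (ε / 2) (half_pos hε)] with n hn
  rw [Real.dist_0_eq_abs, abs_of_nonneg (Real.iSup_nonneg fun _ => abs_nonneg _)]
  refine (Real.iSup_le (fun x => ?_) (half_pos hε).le).trans_lt (half_lt_self hε)
  rw [abs_sub_comm]
  exact (hn x).le

namespace RangeMap.IsOrderDetermined

variable {PT : Measure (Fin q → ℝ)} {PY : Measure ℝ} [IsProbabilityMeasure PY]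

theorem ae_real_cell_pos (hR : R.IsOrderDetermined) :
    ∀ᵐ x ∂PT.prod PY, 0 < PY.real (R.cell x.1 x.2) := by
  have hmeas : MeasurableSet {x : (Fin q → ℝ) × ℝ | 0 < PY.real (R.cell x.1 x.2)} :=
    measurableSet_lt measurable_const (hR.measurable_cell (isProbabilityContent_real PY))
  refine (Measure.ae_prod_iff_ae_ae hmeas).2 (ae_of_all _ fun t => ?_)
  have hnull : ∀ i, PY.real (R.range t i) = 0 → ∀ᵐ y ∂PY, y ∉ R.range t i := fun i hi =>
    measure_eq_zero_iff_ae_notMem.1 ((measureReal_eq_zero_iff).1 hi)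
  filter_upwards [ae_all_iff.2 fun i => eventually_imp_distrib_left.2 (hnull i)] with y hy
  exact measureReal_nonneg.lt_of_ne' fun hzero => hy _ hzero (R.mem_cell t y)

end RangeMap.IsOrderDetermined

theorem IsNPMLE.sum_inv_mul_le {𝒴 : Set ℝ} {n : ℕ} {T : Fin n → Fin q → ℝ} {Y : Fin n → ℝ}
    {F Fhat : ProbabilityMeasure ℝ} (h : IsNPMLE 𝒴 R T Y Fhat) (hF : IsDistributionOn 𝒴 F)
    (hpos : ∀ j, 0 < (F : Measure ℝ).real (R.cell (T j) (Y j))) {δ : ℝ} (hδ : 0 ≤ δ) :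
    ∑ j, ((Fhat : Measure ℝ).real (R.cell (T j) (Y j)) + δ)⁻¹ *
      (F : Measure ℝ).real (R.cell (T j) (Y j)) ≤ n := by
  refine (Finset.sum_le_sum fun j _ => ?_).trans (h.sum_div_le hF hpos)
  rw [div_eq_inv_mul]
  exact mul_le_mul_of_nonneg_right
    (inv_anti₀ (h.real_cell_pos hF hpos j) (le_add_of_nonneg_right hδ)) (hpos j).le

theorem tendsto_cdf_of_isNPMLE {𝒴 : Set ℝ} {PT : Measure (Fin q → ℝ)} [IsProbabilityMeasure PT]
    {PY : Measure ℝ} [IsProbabilityMeasure PY] (h𝒴 : ∀ᵐ y ∂PY, y ∈ 𝒴) (hcont : Continuous (cdf PY))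
    (hres : LocallyResolvable 𝒴 R PT) (hR : R.IsOrderDetermined) {x : ℕ → (Fin q → ℝ) × ℝ}
    (hx : R.IsTypicalSample PT PY x) (hpos : ∀ j, 0 < PY.real (R.cell (x j).1 (x j).2))
    {Fhat : ℕ → ProbabilityMeasure ℝ}
    (hFhat : ∀ n ≥ 1, IsNPMLE 𝒴 R (fun j : Fin n => (x j).1) (fun j : Fin n => (x j).2) (Fhat n))
    (y : ℝ) : Tendsto (fun n => cdf (Fhat n : Measure ℝ) y) atTop (𝓝 (cdf PY y)) := by
  refine (tendsto_iff_ultrafilter _ _ _).2 fun 𝒰 h𝒰 => ?_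
  obtain ⟨M, hM, hlim⟩ := exists_isProbabilityContent_tendsto 𝒰 fun n => (Fhat n : Measure ℝ)
  have hint : ∀ δ > 0,
      ∫ x, (M (R.cell x.1 x.2) + δ)⁻¹ * PY.real (R.cell x.1 x.2) ∂PT.prod PY ≤ 1 := fun δ hδ => by
    refine hx.integral_inv_cell_mul_le_one hR h𝒰 (fun n => isProbabilityContent_real _) hlim hδ
      (((eventually_ge_atTop 1).filter_mono h𝒰).mono fun n hn => ?_)
    rw [Finset.sum_range]
    exact (hFhat n hn).sum_inv_mul_le (F := ⟨PY, inferInstance⟩) h𝒴 (fun j => hpos j) hδ.le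
  have hae := hR.ae_eq_of_integral_inv_cell_mul_le_one hM hint
  rw [← hres.eq_cdf_of_ae_eq hR hcont h𝒴 hM hae y]
  simpa only [cdf_eq_real] using hlim.apply_nhds (Set.Iic y)

end RangePrivacy

end

open RangePrivacy in
theorem mainTheorem3_general {q m : ℕ} {Ω : Type*} [MeasurableSpace Ω] {P : Measure Ω}
    {R : RangeMap q m} {𝒴 : Set ℝ} {PT : Measure (Fin q → ℝ)} [IsProbabilityMeasure PT]
    {PY : Measure ℝ} [IsProbabilityMeasure PY] {X : ℕ → Ω → (Fin q → ℝ) × ℝ}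
    (hX : ∀ j, HasLaw (X j) (PT.prod PY) P)
    (hindep : Pairwise fun i j => IndepFun (X i) (X j) P)
    (h𝒴 : ∀ᵐ y ∂PY, y ∈ 𝒴) (hcont : Continuous (cdf PY)) (hres : LocallyResolvable 𝒴 R PT)
    (hR : R.IsOrderDetermined) {Fhat : ℕ → Ω → ProbabilityMeasure ℝ}
    (hFhat : ∀ n ≥ 1, ∀ᵐ ω ∂P,
      IsNPMLE 𝒴 R (fun j : Fin n => (X j ω).1) (fun j : Fin n => (X j ω).2) (Fhat n ω)) :
    ∀ᵐ ω ∂P, Tendsto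
      (fun n => ⨆ y : 𝒴, |cdf (Fhat n ω : Measure ℝ) (y : ℝ) - cdf PY (y : ℝ)|) atTop (𝓝 0) := by
  have hpos : ∀ᵐ ω ∂P, ∀ j, 0 < PY.real (R.cell (X j ω).1 (X j ω).2) :=
    ae_all_iff.2 fun j => ae_of_ae_map (hX j).aemeasurable <| by
      simpa only [(hX j).map_eq] using hR.ae_real_cell_pos
  have hopt : ∀ᵐ ω ∂P, ∀ n ≥ 1,
      IsNPMLE 𝒴 R (fun j : Fin n => (X j ω).1) (fun j : Fin n => (X j ω).2) (Fhat n ω) :=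
    ae_all_iff.2 fun n => eventually_imp_distrib_left.2 (hFhat n)
  filter_upwards [hR.ae_isTypicalSample hX hindep, hpos, hopt] with ω htypical hpos hopt
  exact tendsto_iSup_abs_sub
    (tendstoUniformly_cdf hcont (tendsto_cdf_of_isNPMLE h𝒴 hcont hres hR htypical hpos hopt)) 𝒴

theorem mainTheorem3 {q m : ℕ} {Ω : Type*} [MeasurableSpace Ω]
    (P : Measure Ω) [IsProbabilityMeasure P]
    (R : RangePrivacy.RangeMap q m) (𝒴 : Set ℝ)
    (PT : Measure (Fin q → ℝ)) [IsProbabilityMeasure PT]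
    (PY : Measure ℝ) [IsProbabilityMeasure PY]
    (T : ℕ → Ω → Fin q → ℝ) (Y : ℕ → Ω → ℝ)
    (hT : ∀ j, HasLaw (T j) PT P) (hY : ∀ j, HasLaw (Y j) PY P)
    (hTY : ∀ j, IndepFun (T j) (Y j) P)
    (hindep : iIndepFun (fun j ω => (T j ω, Y j ω)) P)
    (h𝒴 : ∀ᵐ y ∂PY, y ∈ 𝒴)
    (hcont : Continuous (cdf PY))
    (hres : RangePrivacy.Resolvability 𝒴 R PT)
    (hmono : RangePrivacy.Monotonicity R)
    (Fhat : ℕ → Ω → ProbabilityMeasure ℝ)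
    (hFhat : ∀ n, 1 ≤ n → ∀ᵐ ω ∂P,
      RangePrivacy.IsNPMLE 𝒴 R (fun j : Fin n => T j ω) (fun j : Fin n => Y j ω) (Fhat n ω)) :
    ∀ᵐ ω ∂P, Tendsto
      (fun n => ⨆ y : 𝒴, |cdf (Fhat n ω : Measure ℝ) (y : ℝ) - cdf PY (y : ℝ)|) atTop (𝓝 0) :=
  mainTheorem3_general (fun j => (hTY j).hasLaw_prod (hT j) (hY j))
    (fun _ _ hij => hindep.indepFun hij) h𝒴 hcont hres.2 hmono.isOrderDetermined hFhat
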